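/- Let $(R,\mathfrak m)$ be a Noetherian local ring of dimension $d$ and let $\{M_n\}$ be a sequence of finitely generated $R$-modules of dimension $d$. For a system of parameters $\underline x=x_1,\dots,x_d$ of $R$ write $H_i(\underline x,M)$ for the Koszul homology, $\chi_1(\underline x,M)=\sum_{i=1}^{d}(-1)^{i-1}\ell(H_i(\underline x,M))$, $e(\underline x,M)=\lim_{k\to\infty} d!\,\ell(M/(\underline x)^kM)/k^d$ for the Hilbert--Samuel multiplicity, and $\nu(M)$ for the minimal number of generators. The sequence $\{M_n\}$ is called weakly lim Cohen--Macaulay if $\chi_1(\underline x,M_n)=o(\nu(M_n))$ for some system of parameters $\underline x$ of $R$. For every system of parameters $\underline x$ of $R$ the following three conditions are equivalent: $$\text{(i)}\ \lim_{n\to\infty}\frac{e(\underline x,M_n)}{\ell(M_n/(\underline x)M_n)}=1,\qquad \text{(ii)}\ \lim_{n\to\infty}\frac{\chi_1(\underline x,M_n)}{\ell(M_n/(\underline x)M_n)}=0,\qquad \text{(iii)}\ \chi_1(\underline x,M_n)=o(\nu(M_n)).$$ Moreover, if $\{M_n\}$ is weakly lim Cohen--Macaulay, then (i), (ii) and (iii)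 hold for every system of parameters $\underline x$ of $R$. In particular, the weakly lim Cohen--Macaulay property does not depend on the choice of the system of parameters. -/

import Mathlib

open Filter Topology Asymptotics CategoryTheory

universe u v

namespace LimCM

/-! ### The Koszul complex -/

/-- The index set of the standard basis `e_S`, `S ⊆ {0, …, d-1}`, `#S = i`, of `⋀^i R^d`. -/
abbrev KoszulIndex (d i : ℕ) : Type := {S : Finset (Fin d) // S.card = i}

/-- The sign `(-1)^{#{k ∈ T : k < j}}`, so that `e_{T ∪ {j}}` contributes
`koszulSign T j * x_j` to the coefficient of `e_T` under the Koszul differential (`j ∉ T`). -/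
def koszulSign {d : ℕ} (T : Finset (Fin d)) (j : Fin d) : ℤ :=
  (-1) ^ (T.filter (fun k => k < j)).card

theorem koszulSign_swap {d : ℕ} (T : Finset (Fin d)) {j k : Fin d} (hj : j ∉ T) (hk : k ∉ T)
    (hjk : j ≠ k) :
    koszulSign T j * koszulSign (insert j T) k
      + koszulSign T k * koszulSign (insert k T) j = 0 := by
  wlog h : j < k generalizing j k
  · have h' : k < j := lt_of_le_of_ne (not_lt.mp h) hjk.symm
    rw [add_comm]
    exact this hk hj hjk.symm h'
  · have h1 : ((insert j T).filter (fun l => l < k)).card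
        = (T.filter (fun l => l < k)).card + 1 := by
      rw [Finset.filter_insert, if_pos h, Finset.card_insert_of_notMem]
      simp [hj]
    have h2 : (insert k T).filter (fun l => l < j) = T.filter (fun l => l < j) := by
      rw [Finset.filter_insert, if_neg (not_lt.mpr h.le)]
    unfold koszulSign
    rw [h1, h2]
    ring

section Koszul

variable {R : Type u} [CommRing R] {d : ℕ} (x : Fin d → R)
  (M : Type v) [AddCommGroup M] [Module R M]

/-- The Koszul differential `K_{i+1}(x, M) → K_i(x, M)`, where `K_i(x, M) = M ⊗ ⋀^i R^d` is
identified with the families `(m_S)` of elements of `M` indexed by the `S ⊆ {0, …, d-1}` with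
`#S = i`, that is, with the sums `∑_S m_S e_S`.  It sends `m e_{j₀ < ⋯ < j_i}` to
`∑_r (-1)^r x_{j_r} m e_{j₀ < ⋯ < ĵ_r < ⋯ < j_i}`. -/
def koszulD (i : ℕ) : (KoszulIndex d (i + 1) → M) →ₗ[R] (KoszulIndex d i → M) where
  toFun f T := ∑ j : Fin d,
    if h : j ∉ T.1 then
      koszulSign T.1 j • (x j • f ⟨insert j T.1, by rw [Finset.card_insert_of_notMem h, T.2]⟩)
    else 0
  map_add' f g := by
    funext T
    simp only [Pi.add_apply]
    rw [← Finset.sum_add_distrib]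
    refine Finset.sum_congr rfl fun j _ => ?_
    split_ifs <;> simp [smul_add]
  map_smul' a f := by
    funext T
    simp only [Pi.smul_apply, RingHom.id_apply]
    rw [Finset.smul_sum]
    refine Finset.sum_congr rfl fun j _ => ?_
    split_ifs
    · simp
    · rw [smul_comm (x j) a, smul_comm _ a]

theorem koszulD_apply (i : ℕ) (f : KoszulIndex d (i + 1) → M) (T : KoszulIndex d i) :
    koszulD x M i f T = ∑ j : Fin d,
      if h : j ∉ T.1 then
        koszulSign T.1 j • (x j • f ⟨insert j T.1, by rw [Finset.card_insert_of_notMem h, T.2]⟩)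
      else 0 := rfl

theorem koszulD_comp (i : ℕ) : koszulD x M i ∘ₗ koszulD x M (i + 1) = 0 := by
  refine LinearMap.ext fun f => funext fun T => ?_
  let g : Fin d × Fin d → M := fun p =>
    if h : p.1 ∉ T.1 ∧ p.2 ∉ insert p.1 T.1 then
      (koszulSign T.1 p.1 * koszulSign (insert p.1 T.1) p.2) • ((x p.1 * x p.2) •
        f ⟨insert p.2 (insert p.1 T.1), by
          rw [Finset.card_insert_of_notMem h.2, Finset.card_insert_of_notMem h.1, T.2]⟩)
    else 0
  have key : (koszulD x M i (koszulD x M (i + 1) f)) T = ∑ p : Fin d × Fin d, g p := by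
    rw [Fintype.sum_prod_type g, koszulD_apply]
    refine Finset.sum_congr rfl fun j _ => ?_
    by_cases hj : j ∉ T.1
    · rw [dif_pos hj]
      rw [koszulD_apply]
      rw [Finset.smul_sum, Finset.smul_sum]
      refine Finset.sum_congr rfl fun k _ => ?_
      by_cases hk : k ∉ insert j T.1
      · simp only [g]
        rw [dif_pos hk, dif_pos ⟨hj, hk⟩, smul_comm (x j), smul_smul, smul_smul]
      · simp only [g]
        rw [dif_neg hk, dif_neg (fun h => hk h.2), smul_zero, smul_zero]
    · rw [dif_neg hj]
      symm
      refine Finset.sum_eq_zero fun k _ => ?_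
      simp only [g]
      rw [dif_neg (fun h => hj h.1)]
  change (koszulD x M i (koszulD x M (i + 1) f)) T = 0
  rw [key]
  refine Finset.sum_involution (fun p _ => p.swap) ?_ ?_ (fun _ _ => Finset.mem_univ _)
    (fun _ _ => Prod.swap_swap _)
  · rintro ⟨j, k⟩ -
    by_cases h : j ∉ T.1 ∧ k ∉ insert j T.1
    · obtain ⟨hj, hk⟩ := h
      have hk' := hk
      rw [Finset.mem_insert, not_or] at hk'
      have hj2 : j ∉ insert k T.1 := by
        rw [Finset.mem_insert, not_or]
        exact ⟨fun e => hk'.1 e.symm, hj⟩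
      have hs := koszulSign_swap T.1 hj hk'.2 (fun e => hk'.1 e.symm)
      simp only [g, Prod.swap]
      rw [dif_pos ⟨hj, hk⟩, dif_pos ⟨hk'.2, hj2⟩]
      simp only [Finset.insert_comm j k, mul_comm (x k) (x j)]
      rw [← add_smul, hs, zero_smul]
    · have h' : ¬ (k ∉ T.1 ∧ j ∉ insert k T.1) := by
        rintro ⟨hk, hj⟩
        rw [Finset.mem_insert, not_or] at hj
        refine h ⟨hj.2, ?_⟩
        rw [Finset.mem_insert, not_or]
        exact ⟨fun e => hj.1 e.symm, hk⟩
      simp only [g, Prod.swap]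
      rw [dif_neg h, dif_neg h', add_zero]
  · rintro ⟨j, k⟩ - hne heq
    have e : k = j := congrArg Prod.fst heq
    subst e
    apply hne
    simp only [g]
    rw [dif_neg]
    rintro ⟨-, h⟩
    exact h (Finset.mem_insert_self _ _)

/-- The Koszul complex `K_•(x, M)` of a sequence `x = x_0, …, x_{d-1}` with coefficients in `M`. -/
noncomputable def koszulComplex : ChainComplex (ModuleCat.{v} R) ℕ :=
  ChainComplex.of (fun i => ModuleCat.of R (KoszulIndex d i → M))
    (fun i => ModuleCat.ofHom (koszulD x M i))
    (fun i => by
      rw [← ModuleCat.ofHom_comp, koszulD_comp]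
      rfl)

/-- The length of a module as a natural number (`0` if the length is infinite). -/
noncomputable def len (R : Type u) [CommRing R] (M : Type v) [AddCommGroup M] [Module R M] : ℕ :=
  (Module.length R M).toNat

/-- The first higher Euler characteristic
`χ₁(x, M) = ∑_{i=1}^d (-1)^{i-1} ℓ(H_i(x, M))`. -/
noncomputable def chiOne : ℤ :=
  ∑ i ∈ Finset.Icc 1 d, (-1) ^ (i - 1) * (len R ((koszulComplex x M).homology i) : ℤ)

/-- `ℓ(M / (x)M)`. -/
noncomputable def quotLen : ℕ :=
  len R (M ⧸ (Ideal.span (Set.range x) • (⊤ : Submodule R M)))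

end Koszul

/-! ### Multiplicity, systems of parameters, weakly lim Cohen--Macaulay sequences -/

/-- The Hilbert--Samuel multiplicity `e(I, M) = lim_{k → ∞} d! ℓ(M / I^k M) / k^d`,
where `d = dim R`. -/
noncomputable def hilbertSamuelMultiplicity {R : Type u} [CommRing R] (I : Ideal R)
    (M : Type v) [AddCommGroup M] [Module R M] : ℝ :=
  let d : ℕ := ((ringKrullDim R).unbotD 0).toNat
  limUnder atTop (fun k : ℕ =>
    (d.factorial : ℝ) * (len R (M ⧸ (I ^ k • (⊤ : Submodule R M))) : ℝ) / (k : ℝ) ^ d)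

/-- The minimal number of generators `ν(M)`. -/
noncomputable def minGen (R : Type u) [CommRing R] (M : Type v) [AddCommGroup M] [Module R M] :
    ℕ :=
  (⊤ : Submodule R M).spanFinrank

/-- `x` is a system of parameters of the local ring `R`: it consists of `dim R` elements
and generates an ideal primary to the maximal ideal. -/
def IsSystemOfParameters {R : Type u} [CommRing R] [IsLocalRing R] {d : ℕ} (x : Fin d → R) :
    Prop :=
  ringKrullDim R = d ∧ (Ideal.span (Set.range x)).radical = IsLocalRing.maximalIdeal R

/-- A sequence of finitely generated modules of dimension `dim R` is weakly lim Cohen--Macaulay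
if `χ₁(x, M_n) = o(ν(M_n))` for some system of parameters `x` of `R`. -/
structure IsWeaklyLimCohenMacaulay (R : Type u) [CommRing R] [IsLocalRing R]
    (M : ℕ → Type v) [∀ n, AddCommGroup (M n)] [∀ n, Module R (M n)] : Prop where
  finite : ∀ n, Module.Finite R (M n)
  dim_eq : ∀ n, Module.supportDim R (M n) = ringKrullDim R
  exists_isLittleO : ∃ (d : ℕ) (x : Fin d → R), IsSystemOfParameters x ∧
    (fun n => (chiOne x (M n) : ℝ)) =o[atTop] (fun n => (minGen R (M n) : ℝ))

end LimCM

/-!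
Write `I = (x)` and `P_I(k) = ℓ(M / I ^ k M)`.

The three conditions for a fixed system of parameters are compared through Serre's formula
`e(x, M) = ∑ (-1) ^ i ℓ(H_i(x, M)) = ℓ(M / I M) - χ₁(x, M)` and the inequalities
`ν(M) ≤ ℓ(M / I M) ≤ ν(M) ℓ(R / I)`.  Serre's formula needs neither Hilbert polynomials nor
graded modules.  By the Artin-Rees lemma, a cycle of the Koszul complex in `I ^ (n + 1) K_i` is, for
large `n`, a combination `∑ x_j z_j` of cycles `z_j` in `I ^ n K_i`, hence it is the boundary of
`∑ e_j ∧ z_j` (`eventually_pow_smul_inf_ker_eq_map`).  So for large `k` the subcomplex with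
terms `I ^ (k - i) K_i` is exact, and counting lengths in the quotient complex shows that the `d`-th
difference of `P_I` is eventually equal to the Koszul Euler characteristic
(`eventually_alternating_sum_eq_koszulEulerChar`).  The Gregory-Newton formula then gives the
limit of `d! P_I(k) / k ^ d` (`tendsto_factorial_mul_len_div_pow`).

For the independence of the system of parameters, it is enough to bound `χ₁(y, M)` by a multiple of
`χ₁(x, M)` that does not depend on `M`, since `χ₁` is nonnegative.  With `χ₁ = ℓ(M / I M) - e` this is
a matter of comparing lengths.  If `J` is generated by `d` elements and `I = J + (a)`, filtering
`I ^ k M / J ^ k M` by the modules `I ^ (k - s) J ^ s M` bounds its length by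
`(d + k choose d) ℓ(I M / J M)` (`length_quotient_pow_le`), so `e(J) - e(I) ≤ ℓ(I M / J M)`.  For
`a = 1` this says `χ₁ ≥ 0`; if `I` too has `d` generators it says that `χ₁` does not increase from
`J` to `I` (`chiOne_update_le`).  In the other direction, `χ₁(x_1 ^ t, …, x_d ^ t)` is at most
`t ^ d χ₁(x_1, …, x_d)` (`chiOne_pow_le`).  Together these two moves exchange one element
of a system of parameters for another (`chiOneDominates_update`), and prime avoidance connects
any two systems of parameters by such exchanges (`IsSystemOfParameters.chiOneDominates`).
-/

namespace LimCM

/-! ### Lengths of quotients by powers of ideals -/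

section Filtration

variable {R : Type u} [CommRing R] {M : Type v} [AddCommGroup M] [Module R M]

theorem length_quotient_eq_add {A B : Submodule R M} (h : B ≤ A) :
    Module.length R (M ⧸ B) =
      Module.length R (A ⧸ B.submoduleOf A) + Module.length R (M ⧸ A) := by
  refine Module.length_eq_add_of_exact ((B.submoduleOf A).mapQ B A.subtype le_rfl)
    (Submodule.factor h) ?_ (Submodule.factor_surjective h) ?_
  · rw [← LinearMap.ker_eq_bot, LinearMap.ker_eq_bot']
    intro y hy
    obtain ⟨y, rfl⟩ := Submodule.Quotient.mk_surjective _ y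
    have hy' : (Submodule.Quotient.mk (y : M) : M ⧸ B) = 0 := hy
    rw [Submodule.Quotient.mk_eq_zero] at hy' ⊢
    exact hy'
  · intro y
    obtain ⟨y, rfl⟩ := Submodule.Quotient.mk_surjective _ y
    constructor
    · intro hy
      have hy' : y ∈ A := (Submodule.Quotient.mk_eq_zero A).1 hy
      exact ⟨Submodule.Quotient.mk ⟨y, hy'⟩, rfl⟩
    · rintro ⟨z, hz⟩
      obtain ⟨z, rfl⟩ := Submodule.Quotient.mk_surjective _ z
      rw [← hz]
      exact (Submodule.Quotient.mk_eq_zero A).2 z.2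

theorem length_quotient_anti {A B : Submodule R M} (h : B ≤ A) :
    Module.length R (M ⧸ A) ≤ Module.length R (M ⧸ B) :=
  Module.length_le_of_surjective _ (Submodule.factor_surjective h)

/-- If `N` is generated modulo `N'` by the images of finitely many maps `f i : L → M`, each of
which sends `K` into `N'`, then `N / N'` has length at most `#ι * ℓ(L / K)`. -/
theorem length_quotient_le_add_card_mul {ι : Type*} [Fintype ι] {L : Type*} [AddCommGroup L]
    [Module R L] (K : Submodule R L) (f : ι → L →ₗ[R] M) {N N' : Submodule R M}
    (hK : ∀ i, K ≤ N'.comap (f i)) (hN : N ≤ N' ⊔ ⨆ i, LinearMap.range (f i)) :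
    Module.length R (M ⧸ N') ≤
      Module.length R (M ⧸ N) + Fintype.card ι * Module.length R (L ⧸ K) := by
  -- `g` maps the direct sum of copies of `L / K` onto the image of `N` in `M / N'`.
  classical
  let g : (ι → L ⧸ K) →ₗ[R] M ⧸ N' :=
    LinearMap.lsum R (fun _ : ι => L ⧸ K) R fun i => K.mapQ N' (f i) (hK i)
  have hg : ∀ i y, N'.mkQ (f i y) ∈ LinearMap.range g := fun i y =>
    ⟨Pi.single i (K.mkQ y), LinearMap.lsum_piSingle ..⟩
  have hN' : N ≤ (LinearMap.range g).comap N'.mkQ := by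
    refine hN.trans (sup_le ?_ (iSup_le fun i => ?_))
    · intro y hy
      rw [Submodule.mem_comap, (N'.mkQ_apply y), (Submodule.Quotient.mk_eq_zero N').2 hy]
      exact zero_mem _
    · rintro _ ⟨y, rfl⟩
      exact hg i y
  have h1 := Module.length_eq_add_of_exact (LinearMap.range g).subtype (LinearMap.range g).mkQ
    (Submodule.subtype_injective _) (Submodule.mkQ_surjective _)
    (LinearMap.exact_subtype_mkQ _)
  have h2 : Module.length R (LinearMap.range g) ≤ Fintype.card ι * Module.length R (L ⧸ K) := by
    refine (Module.length_le_of_surjective _ g.surjective_rangeRestrict).trans_eq ?_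
    rw [Module.length_pi_of_fintype, Finset.sum_const, nsmul_eq_mul]
    rfl
  have h3 : Module.length R ((M ⧸ N') ⧸ LinearMap.range g) ≤ Module.length R (M ⧸ N) := by
    refine Module.length_le_of_surjective (N.mapQ _ N'.mkQ hN') ?_
    refine fun y => ?_
    obtain ⟨y, rfl⟩ := Submodule.Quotient.mk_surjective _ y
    obtain ⟨y, rfl⟩ := Submodule.Quotient.mk_surjective _ y
    exact ⟨N.mkQ y, rfl⟩
  rw [h1, add_comm]
  exact add_le_add h3 h2

theorem span_range_pow_eq_span_sym {d : ℕ} (y : Fin d → R) (s : ℕ) :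
    Ideal.span (Set.range y) ^ s =
      Ideal.span (Set.range fun σ : Sym (Fin d) s => ((σ : Multiset (Fin d)).map y).prod) := by
  induction s with
  | zero =>
    rw [pow_zero, Ideal.one_eq_top, eq_comm, Ideal.eq_top_iff_one]
    exact Ideal.subset_span ⟨Sym.nil, by simp⟩
  | succ s ih =>
    rw [pow_succ', ih, Ideal.span_mul_span']
    congr 1
    ext r
    rw [Set.mem_mul]
    constructor
    · rintro ⟨_, ⟨i, rfl⟩, _, ⟨σ, rfl⟩, rfl⟩
      exact ⟨i ::ₛ σ, by simp [Sym.coe_cons]⟩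
    · rintro ⟨τ, rfl⟩
      obtain ⟨i, σ, rfl⟩ := τ.exists_eq_cons_of_succ
      exact ⟨y i, ⟨i, rfl⟩, _, ⟨σ, rfl⟩, by simp [Sym.coe_cons]⟩

/-- A product of `p + 1` factors from `J` or `(a)` that has no factor in `J` is a multiple of
`a ^ p * a`. -/
theorem sup_span_singleton_pow_succ_le (J : Ideal R) (a : R) (p : ℕ) :
    (J ⊔ Ideal.span {a}) ^ (p + 1) ≤
      Ideal.span {a ^ p} * (J ⊔ Ideal.span {a}) ⊔ J * (J ⊔ Ideal.span {a}) ^ p := by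
  set I := J ⊔ Ideal.span {a} with hI
  have haI : Ideal.span {a} ≤ I := le_sup_right
  induction p with
  | zero => simp
  | succ p ih =>
    have h1 : Ideal.span {a ^ p} * I * I ≤
        Ideal.span {a ^ (p + 1)} * I ⊔ J * I ^ (p + 1) := by
      have : Ideal.span {a ^ p} * I * I =
          Ideal.span {a ^ p} * I * J ⊔ Ideal.span {a ^ p} * I * Ideal.span {a} := by
        conv_lhs => rw [hI, Ideal.mul_sup]
      rw [this, sup_comm]
      refine sup_le_sup ?_ ?_
      · rw [mul_right_comm, Ideal.span_singleton_mul_span_singleton, ← pow_succ]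
      · rw [mul_comm _ J, pow_succ, ← Ideal.span_singleton_pow]
        exact Ideal.mul_mono_right (Ideal.mul_mono_left (Ideal.pow_right_mono haI p))
    calc I ^ (p + 1 + 1) = I ^ (p + 1) * I := pow_succ _ _
      _ ≤ (Ideal.span {a ^ p} * I ⊔ J * I ^ p) * I := Ideal.mul_mono_left ih
      _ = Ideal.span {a ^ p} * I * I ⊔ J * I ^ (p + 1) := by
        rw [Ideal.sup_mul, mul_assoc J, ← pow_succ]
      _ ≤ _ := sup_le h1 le_sup_right

/-- One step of the filtration of `I ^ k M / J ^ k M` by the modules `I ^ (k - s) J ^ s M`, where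
`J` is generated by `y` and `I = J + (a)`: modulo the next term, the module is generated by the
multiples of `I M` by the elements `a ^ p * y ^ α` with `|α| = s`, and these kill `J M`. -/
theorem length_quotient_pow_mul_pow_le {d : ℕ} (y : Fin d → R) (a : R) (p s : ℕ) {I J : Ideal R}
    (hJ : J = Ideal.span (Set.range y)) (hI : I = J ⊔ Ideal.span {a}) :
    Module.length R (M ⧸ ((I ^ p * J ^ (s + 1)) • (⊤ : Submodule R M))) ≤
      Module.length R (M ⧸ ((I ^ (p + 1) * J ^ s) • (⊤ : Submodule R M))) +
        (d.multichoose s : ℕ) * Module.length R (↥(I • (⊤ : Submodule R M)) ⧸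
          (J • (⊤ : Submodule R M)).submoduleOf (I • ⊤)) := by
  have hcard : d.multichoose s = Fintype.card (Sym (Fin d) s) := by
    rw [Sym.card_sym_eq_multichoose, Fintype.card_fin]
  have haI : a ∈ I := hI ▸ Ideal.mem_sup_right (Ideal.mem_span_singleton_self a)
  let mon : Sym (Fin d) s → R := fun σ => ((σ : Multiset (Fin d)).map y).prod
  have hJs : J ^ s = Ideal.span (Set.range mon) := hJ ▸ span_range_pow_eq_span_sym y s
  have hmon : ∀ σ, mon σ ∈ J ^ s := fun σ => hJs ▸ Ideal.subset_span ⟨σ, rfl⟩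
  rw [hcard]
  refine length_quotient_le_add_card_mul _
    (fun σ => (a ^ p * mon σ) • (I • (⊤ : Submodule R M)).subtype) (fun σ => ?_) ?_
  · intro z hz
    have hz' : (z : M) ∈ J • (⊤ : Submodule R M) := hz
    change (a ^ p * mon σ) • (z : M) ∈ (I ^ p * J ^ (s + 1)) • (⊤ : Submodule R M)
    rw [pow_succ, ← mul_assoc, mul_smul (I ^ p * J ^ s)]
    exact Submodule.smul_mem_smul (Ideal.mul_mem_mul (Ideal.pow_mem_pow haI p) (hmon σ)) hz'
  · have h1 : I ^ (p + 1) * J ^ s ≤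
        (I ^ p * J ^ (s + 1)) ⊔ (Ideal.span {a ^ p} * J ^ s) * I := by
      have := Ideal.mul_mono_left (K := J ^ s) (hI ▸ sup_span_singleton_pow_succ_le J a p)
      refine this.trans ?_
      rw [Ideal.sup_mul, sup_comm, mul_right_comm _ I, mul_comm J (I ^ p), mul_assoc _ J,
        ← pow_succ']
    refine (Submodule.smul_mono_left h1).trans ?_
    rw [Submodule.sup_smul]
    refine sup_le_sup le_rfl ?_
    rw [mul_smul, hJs, Ideal.span_mul_span', Submodule.smul_le]
    intro r hr n hn
    induction hr using Submodule.span_induction with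
    | mem r hr =>
      obtain ⟨_, rfl, _, ⟨σ, rfl⟩, rfl⟩ := Set.mem_mul.1 hr
      exact Submodule.mem_iSup_of_mem σ ⟨⟨n, hn⟩, rfl⟩
    | zero => rw [zero_smul]; exact zero_mem _
    | add r r' _ _ h h' => rw [add_smul]; exact add_mem h h'
    | smul c r _ h => rw [smul_assoc]; exact Submodule.smul_mem _ c h

theorem sum_multichoose_le_choose (d k : ℕ) :
    ∑ s ∈ Finset.range k, d.multichoose s ≤ (d + k).choose d := by
  have h : ∀ k, ∑ s ∈ Finset.range (k + 1), d.multichoose s = (d + 1).multichoose k := by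
    intro k
    induction k with
    | zero => simp
    | succ k ih => rw [Finset.sum_range_succ, ih, Nat.multichoose_succ_succ, add_comm]
  calc _ ≤ ∑ s ∈ Finset.range (k + 1), d.multichoose s := by
        rw [Finset.sum_range_succ]; exact Nat.le_add_right _ _
    _ = _ := by
        rw [h, Nat.multichoose_eq, add_right_comm, Nat.add_sub_cancel, Nat.choose_symm_add]

/-- If `J` is generated by `d` elements and `I = J + (a)`, then `I ^ k M / J ^ k M` has length at
most `(d + k choose d) * ℓ(I M / J M)`. -/
theorem length_quotient_pow_le {d : ℕ} (y : Fin d → R) (a : R) (k : ℕ) {I J : Ideal R}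
    (hJ : J = Ideal.span (Set.range y)) (hI : I = J ⊔ Ideal.span {a}) :
    Module.length R (M ⧸ (J ^ k • (⊤ : Submodule R M))) ≤
      Module.length R (M ⧸ (I ^ k • (⊤ : Submodule R M))) +
        ((d + k).choose d : ℕ) * Module.length R (↥(I • (⊤ : Submodule R M)) ⧸
          (J • (⊤ : Submodule R M)).submoduleOf (I • ⊤)) := by
  set c := Module.length R (↥(I • (⊤ : Submodule R M)) ⧸
          (J • (⊤ : Submodule R M)).submoduleOf (I • ⊤))
  have key : ∀ s ≤ k, Module.length R (M ⧸ ((I ^ (k - s) * J ^ s) • (⊤ : Submodule R M))) ≤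
      Module.length R (M ⧸ (I ^ k • (⊤ : Submodule R M))) +
        (∑ r ∈ Finset.range s, d.multichoose r : ℕ) * c := by
    intro s
    induction s with
    | zero =>
      intro _
      rw [Nat.sub_zero, pow_zero, mul_one]
      exact le_self_add
    | succ s ih =>
      intro hs
      have h1 := length_quotient_pow_mul_pow_le (M := M) y a (k - (s + 1)) s hJ hI
      rw [show k - (s + 1) + 1 = k - s by omega] at h1
      refine h1.trans ((add_le_add_left (ih (by omega)) _).trans_eq ?_)
      rw [Finset.sum_range_succ, Nat.cast_add, add_mul, add_assoc]
  have h := key k le_rfl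
  rw [Nat.sub_self, pow_zero, one_mul] at h
  refine h.trans ?_
  gcongr
  exact sum_multichoose_le_choose d k

theorem span_range_update_le_iff {d : ℕ} {w : Fin d → R} {i : Fin d} {a : R} {K : Ideal R} :
    Ideal.span (Set.range (Function.update w i a)) ≤ K ↔ a ∈ K ∧ ∀ j ≠ i, w j ∈ K := by
  rw [Ideal.span_le, Set.range_subset_iff]
  exact Function.forall_update_iff w (p := fun _ r => r ∈ (K : Set R))

/-- The quotient by `(…, w i ^ t, …)` is filtered by the powers `w i ^ s`, `s < t`, with factors
quotients of `M / (w) M`. -/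
theorem length_quotient_update_pow_le {d : ℕ} (w : Fin d → R) (i : Fin d) (t : ℕ) :
    Module.length R (M ⧸
        (Ideal.span (Set.range (Function.update w i (w i ^ t))) • (⊤ : Submodule R M))) ≤
      t * Module.length R (M ⧸ (Ideal.span (Set.range w) • (⊤ : Submodule R M))) := by
  induction t with
  | zero =>
    have : Ideal.span (Set.range (Function.update w i (w i ^ 0))) = ⊤ := by
      rw [Ideal.eq_top_iff_one]
      exact Ideal.subset_span ⟨i, by simp⟩
    rw [this, Submodule.top_smul, Nat.cast_zero, zero_mul, nonpos_iff_eq_zero]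
    exact Module.length_eq_zero
  | succ t ih =>
    set J := Ideal.span (Set.range (Function.update w i (w i ^ (t + 1)))) with hJ
    obtain ⟨hJi, hJj⟩ := span_range_update_le_iff.1 hJ.ge
    have h := length_quotient_le_add_card_mul (ι := Unit) (N' := J • (⊤ : Submodule R M))
      (N := Ideal.span (Set.range (Function.update w i (w i ^ t))) • (⊤ : Submodule R M))
      (Ideal.span (Set.range w) • (⊤ : Submodule R M)) (fun _ => w i ^ t • LinearMap.id) ?_ ?_
    · rw [Fintype.card_unit, Nat.cast_one, one_mul] at h
      refine h.trans ((add_le_add_left ih _).trans_eq ?_)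
      rw [Nat.cast_add, add_mul, Nat.cast_one, one_mul]
    · intro _
      rw [Submodule.smul_le]
      intro r hr n _
      rw [Submodule.mem_comap, LinearMap.smul_apply, LinearMap.id_apply, smul_smul]
      refine Submodule.smul_mem_smul ?_ trivial
      have : Ideal.span (Set.range w) ≤ Submodule.comap (w i ^ t • LinearMap.id) J := by
        rw [Ideal.span_le]
        rintro _ ⟨j, rfl⟩
        change w i ^ t * w j ∈ J
        by_cases hj : j = i
        · rw [hj, ← pow_succ]; exact hJi
        · exact J.mul_mem_left _ (hJj j hj)
      exact this hr
    · have h2 : Ideal.span (Set.range (Function.update w i (w i ^ t))) ≤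
          J ⊔ Ideal.span {w i ^ t} :=
        span_range_update_le_iff.2 ⟨Ideal.mem_sup_right (Ideal.mem_span_singleton_self _),
          fun j hj => Ideal.mem_sup_left (hJj j hj)⟩
      refine (Submodule.smul_mono_left h2).trans ?_
      rw [Submodule.sup_smul]
      refine sup_le_sup le_rfl ?_
      rw [Submodule.smul_le]
      intro r hr n _
      obtain ⟨c, rfl⟩ := Ideal.mem_span_singleton'.1 hr
      exact Submodule.mem_iSup_of_mem () ⟨c • n, by simp [smul_smul]⟩

theorem length_quotient_pow_vector_le {d : ℕ} (w : Fin d → R) (t : ℕ) :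
    Module.length R (M ⧸
        (Ideal.span (Set.range fun j => w j ^ t) • (⊤ : Submodule R M))) ≤
      (t ^ d : ℕ) * Module.length R (M ⧸ (Ideal.span (Set.range w) • (⊤ : Submodule R M))) := by
  have key : ∀ S : Finset (Fin d), Module.length R (M ⧸
        (Ideal.span (Set.range (S.piecewise (fun j => w j ^ t) w)) • (⊤ : Submodule R M))) ≤
      (t ^ S.card : ℕ) *
        Module.length R (M ⧸ (Ideal.span (Set.range w) • (⊤ : Submodule R M))) := by
    intro S
    induction S using Finset.induction_on with
    | empty => rw [Finset.piecewise_empty, Finset.card_empty, pow_zero, Nat.cast_one, one_mul]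
    | insert i S hi ih =>
      have h := length_quotient_update_pow_le (M := M) (S.piecewise (fun j => w j ^ t) w) i t
      rw [Finset.piecewise_eq_of_notMem _ _ _ hi] at h
      rw [Finset.piecewise_insert, Finset.card_insert_of_notMem hi]
      refine h.trans ((mul_le_mul_right ih _).trans_eq ?_)
      rw [← mul_assoc, ← Nat.cast_mul, pow_succ']
  have h := key Finset.univ
  rwa [Finset.piecewise_univ, Finset.card_univ, Fintype.card_fin] at h

end Filtration

/-! ### Koszul homology and its contracting homotopies -/

section KoszulHomology

variable {R : Type u} [CommRing R] {d : ℕ} (x : Fin d → R)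
  (M : Type v) [AddCommGroup M] [Module R M]

/-- The Koszul differential leaving degree `i`; it is zero in degree `0`, where its target is
the junk value `K_{0 - 1} = K_0`. -/
def koszulDFrom : (i : ℕ) → (KoszulIndex d i → M) →ₗ[R] (KoszulIndex d (i - 1) → M)
  | 0 => 0
  | i + 1 => koszulD x M i

/-- Exterior multiplication by the basis vector `e_j`, as a map `K_i(x, M) → K_{i+1}(x, M)`. -/
def koszulWedge (R : Type u) [CommRing R] {d : ℕ} (M : Type v) [AddCommGroup M] [Module R M]
    (j : Fin d) (i : ℕ) : (KoszulIndex d i → M) →ₗ[R] (KoszulIndex d (i + 1) → M) where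
  toFun f S := if h : j ∈ S.1 then
      koszulSign (S.1.erase j) j • f ⟨S.1.erase j, by
        rw [Finset.card_erase_of_mem h, S.2, Nat.add_sub_cancel]⟩
    else 0
  map_add' f g := by
    funext S
    by_cases h : j ∈ S.1 <;> simp [h]
  map_smul' a f := by
    funext S
    by_cases h : j ∈ S.1
    · simp [h, smul_comm a]
    · simp [h]

theorem koszulSign_mul_self (T : Finset (Fin d)) (j : Fin d) :
    koszulSign T j * koszulSign T j = 1 := by
  rw [koszulSign, ← mul_pow]
  simp

theorem koszulSign_mul_koszulSign_insert (T : Finset (Fin d)) {j k : Fin d} (hj : j ∉ T)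
    (hk : k ∉ T) (hjk : j ≠ k) :
    koszulSign (insert j T) k * koszulSign (insert k T) j = - (koszulSign T j * koszulSign T k) := by
  have h := koszulSign_swap T hj hk hjk
  have h1 := koszulSign_mul_self T j
  have h2 := koszulSign_mul_self (insert k T) j
  linear_combination (koszulSign T j * koszulSign (insert k T) j) * h
    - koszulSign (insert j T) k * koszulSign (insert k T) j * h1
    - koszulSign T j * koszulSign T k * h2

variable {M}

theorem koszulD_koszulWedge_apply_of_notMem (j : Fin d) (i : ℕ) (z : KoszulIndex d i → M)
    (T : KoszulIndex d i) (hj : j ∉ T.1) :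
    koszulD x M i (koszulWedge R M j i z) T = x j • z T := by
  rw [koszulD_apply, Finset.sum_eq_single j]
  · rw [dif_pos hj]
    have h : j ∈ insert j T.1 := Finset.mem_insert_self _ _
    simp only [koszulWedge, LinearMap.coe_mk, AddHom.coe_mk, dif_pos h,
      Finset.erase_insert hj]
    rw [smul_comm (x j), smul_smul, koszulSign_mul_self, one_smul]
  · intro l _ hl
    by_cases h : l ∉ T.1
    · have h' : j ∉ insert l T.1 := by
        rw [Finset.mem_insert, not_or]; exact ⟨fun e => hl e.symm, hj⟩
      rw [dif_pos h]
      simp only [koszulWedge, LinearMap.coe_mk, AddHom.coe_mk, dif_neg h', smul_zero]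
    · exact dif_neg h
  · exact fun h => absurd (Finset.mem_univ _) h

theorem koszulD_koszulWedge_of_koszulD_eq_zero (j : Fin d) (i : ℕ)
    (z : KoszulIndex d (i + 1) → M) (hz : koszulD x M i z = 0) :
    koszulD x M (i + 1) (koszulWedge R M j (i + 1) z) = x j • z := by
  funext T
  by_cases hj : j ∉ T.1
  · exact koszulD_koszulWedge_apply_of_notMem x j _ z T hj
  rw [not_not] at hj
  obtain ⟨T, hT⟩ := T
  obtain ⟨T, hjT, rfl⟩ : ∃ T' : Finset (Fin d), j ∉ T' ∧ T = insert j T' :=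
    ⟨T.erase j, Finset.notMem_erase _ _, (Finset.insert_erase hj).symm⟩
  have hcard : T.card = i := by
    rw [Finset.card_insert_of_notMem hjT] at hT; omega
  have h0 := congrFun hz ⟨T, hcard⟩
  rw [koszulD_apply, ← Finset.add_sum_erase _ _ (Finset.mem_univ j), dif_pos hjT,
    Pi.zero_apply] at h0
  have h1 := congrArg (koszulSign T j • ·) h0
  simp only [smul_add, smul_smul, koszulSign_mul_self, one_smul, smul_zero] at h1
  rw [koszulD_apply, ← Finset.add_sum_erase _ _ (Finset.mem_univ j), dif_neg (by simp),
    zero_add, Pi.smul_apply, eq_neg_of_add_eq_zero_left h1, Finset.smul_sum,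
    ← Finset.sum_neg_distrib]
  refine Finset.sum_congr rfl fun l hl => ?_
  have hlj : l ≠ j := Finset.ne_of_mem_erase hl
  by_cases hlT : l ∉ T
  · have hl' : l ∉ insert j T := by
      rw [Finset.mem_insert, not_or]; exact ⟨hlj, hlT⟩
    have hjl : j ∈ insert l (insert j T) := by simp
    have he : (insert l (insert j T)).erase j = insert l T := by
      rw [Finset.insert_comm, Finset.erase_insert]
      rw [Finset.mem_insert, not_or]
      exact ⟨fun e => hlj e.symm, hjT⟩
    rw [dif_pos hl', dif_pos hlT]
    simp only [koszulWedge, LinearMap.coe_mk, AddHom.coe_mk, dif_pos hjl, he]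
    rw [smul_comm (x l), smul_smul, smul_smul,
      koszulSign_mul_koszulSign_insert T hjT hlT (fun e => hlj e.symm), neg_smul]
  · have hl' : ¬ l ∉ insert j T := by
      rw [not_not] at hlT ⊢; exact Finset.mem_insert_of_mem hlT
    rw [dif_neg hl', dif_neg hlT, smul_zero, neg_zero]

/-- On cycles, exterior multiplication by `e_j` is a homotopy from multiplication by `x_j` to
zero. -/
theorem koszulD_koszulWedge (j : Fin d) : ∀ (i : ℕ) (z : KoszulIndex d i → M),
    koszulDFrom x M i z = 0 → koszulD x M i (koszulWedge R M j i z) = x j • z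
  | 0, z, _ => funext fun T => koszulD_koszulWedge_apply_of_notMem x j 0 z T (by
      rw [Finset.card_eq_zero.1 T.2]; exact Finset.notMem_empty j)
  | i + 1, z, hz => koszulD_koszulWedge_of_koszulD_eq_zero x j i z hz

theorem range_koszulD_le_ker (i : ℕ) :
    LinearMap.range (koszulD x M i) ≤ LinearMap.ker (koszulDFrom x M i) := by
  cases i with
  | zero => exact fun _ _ => LinearMap.mem_ker.2 rfl
  | succ i => exact LinearMap.range_le_ker_iff.2 (koszulD_comp x M i)

theorem smul_top_pi {ι : Type*} [Finite ι] (J : Ideal R) :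
    J • (⊤ : Submodule R (ι → M)) = Submodule.pi Set.univ fun _ => J • (⊤ : Submodule R M) := by
  classical
  have := Fintype.ofFinite ι
  refine le_antisymm ?_ fun f hf => ?_
  · rw [Submodule.smul_le]
    exact fun r hr f _ i _ => Submodule.smul_mem_smul hr trivial
  · rw [← Finset.univ_sum_single f]
    refine Submodule.sum_mem _ fun i _ => ?_
    have h : (J • (⊤ : Submodule R M)).map (LinearMap.single R (fun _ : ι => M) i) ≤
        J • (⊤ : Submodule R (ι → M)) := by
      rw [Submodule.map_smul'']
      exact Submodule.smul_mono le_rfl le_top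
    exact h ⟨f i, hf i trivial, rfl⟩

theorem length_pi_quotient_smul_top {ι : Type*} [Fintype ι] (J : Ideal R) :
    Module.length R ((ι → M) ⧸ (J • (⊤ : Submodule R (ι → M)))) =
      Fintype.card ι * Module.length R (M ⧸ (J • (⊤ : Submodule R M))) := by
  classical
  rw [smul_top_pi, (Submodule.quotientPi fun _ : ι => J • (⊤ : Submodule R M)).length_eq,
    Module.length_pi_of_fintype, Finset.sum_const, nsmul_eq_mul]
  rfl

theorem range_koszulD_le_smul_top (i : ℕ) :
    LinearMap.range (koszulD x M i) ≤ Ideal.span (Set.range x) • ⊤ := by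
  rw [smul_top_pi]
  rintro _ ⟨f, rfl⟩ T _
  rw [koszulD_apply]
  refine Submodule.sum_mem _ fun j _ => ?_
  by_cases h : j ∉ T.1
  · rw [dif_pos h]
    have hj : x j ∈ Ideal.span (Set.range x) := Ideal.subset_span ⟨j, rfl⟩
    exact zsmul_mem (Submodule.smul_mem_smul hj Submodule.mem_top) _
  · rw [dif_neg h]
    exact zero_mem _

/-- If `Z` consists of cycles of degree `i` lying in `J K_i`, then `(x) Z` lies in the image of
`J K_{i+1}` under the Koszul differential. -/
theorem span_smul_le_map_koszulD (i : ℕ) (J : Ideal R) (Z : Submodule R (KoszulIndex d i → M))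
    (hZ : Z ≤ LinearMap.ker (koszulDFrom x M i)) (hJ : Z ≤ J • ⊤) :
    Ideal.span (Set.range x) • Z ≤ (J • ⊤ : Submodule R _).map (koszulD x M i) := by
  rw [Submodule.smul_le]
  intro r hr z hz
  induction hr using Submodule.span_induction with
  | mem r hr =>
    obtain ⟨j, rfl⟩ := hr
    refine ⟨koszulWedge R M j i z, ?_, koszulD_koszulWedge x j i z (hZ hz)⟩
    have h : (J • (⊤ : Submodule R (KoszulIndex d i → M))).map (koszulWedge R M j i) ≤ J • ⊤ := by
      rw [Submodule.map_smul'']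
      exact Submodule.smul_mono le_rfl le_top
    exact h ⟨z, hJ hz, rfl⟩
  | zero => rw [zero_smul]; exact zero_mem _
  | add r r' _ _ h h' => rw [add_smul]; exact add_mem h h'
  | smul c r _ h => rw [smul_assoc]; exact Submodule.smul_mem _ c h

/-- For large `n`, the subcomplex of the Koszul complex with terms `I ^ (n + 1) K_i` and
`I ^ n K_{i+1}`, where `I = (x)`, is exact in degree `i`: by the Artin-Rees lemma the cycles in
`I ^ (n + 1) K_i` are combinations, with coefficients in `I`, of cycles in `I ^ n K_i`. -/
theorem eventually_pow_smul_inf_ker_eq_map [IsNoetherianRing R] [Module.Finite R M] (i : ℕ) :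
    ∃ c : ℕ, ∀ n ≥ c,
      (Ideal.span (Set.range x) ^ (n + 1) • ⊤ ⊓ LinearMap.ker (koszulDFrom x M i) :
        Submodule R (KoszulIndex d i → M)) =
      (Ideal.span (Set.range x) ^ n • ⊤ : Submodule R _).map (koszulD x M i) := by
  set I := Ideal.span (Set.range x) with hI
  obtain ⟨c, hc⟩ := I.exists_pow_inf_eq_pow_smul (LinearMap.ker (koszulDFrom x M i))
  refine ⟨c, fun n hn => le_antisymm ?_ (le_inf ?_ ?_)⟩
  · rw [hc (n + 1) (by omega), Nat.sub_add_comm hn, pow_succ', mul_smul, ← hc n hn]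
    exact span_smul_le_map_koszulD x i _ _ inf_le_right inf_le_left
  · rw [Submodule.map_smul'', pow_succ, mul_smul, Submodule.map_top]
    exact Submodule.smul_mono le_rfl (range_koszulD_le_smul_top x i)
  · exact LinearMap.map_le_range.trans (range_koszulD_le_ker x i)

theorem range_koszulD_zero :
    LinearMap.range (koszulD x M 0) = Ideal.span (Set.range x) • ⊤ := by
  refine le_antisymm (range_koszulD_le_smul_top x 0) ?_
  refine (span_smul_le_map_koszulD x 0 ⊤ ⊤ (fun _ _ => LinearMap.mem_ker.2 rfl) ?_).trans
    LinearMap.map_le_range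
  rw [Submodule.top_smul]

theorem length_homology_eq (S : ShortComplex (ModuleCat.{v} R)) :
    Module.length R S.homology = Module.length R (LinearMap.ker S.g.hom ⧸
      (LinearMap.range S.f.hom).submoduleOf (LinearMap.ker S.g.hom)) := by
  rw [S.moduleCatHomologyIso.toLinearEquiv.length_eq]
  have h : LinearMap.range S.moduleCatToCycles =
      (LinearMap.range S.f.hom).submoduleOf (LinearMap.ker S.g.hom) := by
    ext z
    constructor
    · rintro ⟨y, rfl⟩
      exact ⟨y, rfl⟩
    · rintro ⟨y, hy⟩
      exact ⟨y, Subtype.ext hy⟩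
  rw [← h]
  rfl

variable (M) in
/-- The length of the `i`-th Koszul homology, computed as cycles modulo boundaries. -/
noncomputable def koszulHomologyLength (i : ℕ) : ℕ∞ :=
  Module.length R (LinearMap.ker (koszulDFrom x M i) ⧸
    (LinearMap.range (koszulD x M i)).submoduleOf (LinearMap.ker (koszulDFrom x M i)))

theorem length_koszulComplex_homology (i : ℕ) :
    Module.length R ((koszulComplex x M).homology i) = koszulHomologyLength x M i := by
  have hf : (koszulComplex x M).d (i + 1) i = ModuleCat.ofHom (koszulD x M i) :=
    ChainComplex.of_d (fun i => ModuleCat.of R (KoszulIndex d i → M))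
      (fun i => ModuleCat.ofHom (koszulD x M i)) i
  have hg : (koszulComplex x M).d i (i - 1) = ModuleCat.ofHom (koszulDFrom x M i) := by
    cases i with
    | zero => exact (koszulComplex x M).shape _ _ (by simp)
    | succ i =>
      exact ChainComplex.of_d (fun i => ModuleCat.of R (KoszulIndex d i → M))
        (fun i => ModuleCat.ofHom (koszulD x M i)) i
  have hnext : (ComplexShape.down ℕ).next i = i - 1 := by
    cases i with
    | zero => exact ChainComplex.next_nat_zero
    | succ i => exact ChainComplex.next_nat_succ i
  have e := ShortComplex.homologyMapIso
    ((koszulComplex x M).isoSc' (i + 1) i (i - 1) (ChainComplex.prev ℕ i) hnext)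
  refine (e.toLinearEquiv.length_eq).trans ((length_homology_eq _).trans ?_)
  change Module.length R (LinearMap.ker ((koszulComplex x M).d i (i - 1)).hom ⧸
      (LinearMap.range ((koszulComplex x M).d (i + 1) i).hom).submoduleOf
        (LinearMap.ker ((koszulComplex x M).d i (i - 1)).hom)) = _
  rw [hf, hg]
  rfl

end KoszulHomology

/-! ### The Euler characteristic of the Koszul complex as a finite difference -/

section EulerCharacteristic

variable {R : Type u} [CommRing R]

/-- If the image of `F` under `f` is the part of `F'` in the range of `f`, then passing to the
quotients by `F` and `F'` keeps the kernel and the range of `f` exact. -/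
theorem length_quotient_eq_add_of_map_eq {C C' : Type*} [AddCommGroup C] [Module R C]
    [AddCommGroup C'] [Module R C'] (f : C →ₗ[R] C') {F : Submodule R C} {F' : Submodule R C'}
    (h : F' ⊓ LinearMap.range f = F.map f) :
    Module.length R (C ⧸ F) = Module.length R (LinearMap.ker f ⧸ F.submoduleOf (LinearMap.ker f)) +
      Module.length R (LinearMap.range f ⧸ F'.submoduleOf (LinearMap.range f)) := by
  have hF : F ≤ (F'.submoduleOf (LinearMap.range f)).comap f.rangeRestrict := fun y hy =>
    (h.ge ⟨y, hy, rfl⟩ : f y ∈ F' ⊓ LinearMap.range f).1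
  refine Module.length_eq_add_of_exact
    ((F.submoduleOf (LinearMap.ker f)).mapQ F (LinearMap.ker f).subtype le_rfl)
    (F.mapQ _ f.rangeRestrict hF) ?_ ?_ ?_
  · rw [← LinearMap.ker_eq_bot, LinearMap.ker_eq_bot']
    intro y hy
    obtain ⟨y, rfl⟩ := Submodule.Quotient.mk_surjective _ y
    have hy' : (Submodule.Quotient.mk (y : C) : C ⧸ F) = 0 := hy
    rw [Submodule.Quotient.mk_eq_zero] at hy' ⊢
    exact hy'
  · intro z
    obtain ⟨⟨_, y, rfl⟩, rfl⟩ := Submodule.Quotient.mk_surjective _ z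
    exact ⟨Submodule.Quotient.mk y, rfl⟩
  · intro y
    obtain ⟨y, rfl⟩ := Submodule.Quotient.mk_surjective _ y
    constructor
    · intro hy
      have hy1 : (Submodule.Quotient.mk (f.rangeRestrict y) :
        LinearMap.range f ⧸ F'.submoduleOf (LinearMap.range f)) = 0 := hy
      rw [Submodule.Quotient.mk_eq_zero] at hy1
      have hy' : f y ∈ F' := hy1
      obtain ⟨w, hw, hwy⟩ := h.le ⟨hy', y, rfl⟩
      have hk : y - w ∈ LinearMap.ker f := by rw [LinearMap.mem_ker, map_sub, hwy, sub_self]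
      refine ⟨Submodule.Quotient.mk ⟨y - w, hk⟩, ?_⟩
      refine ((Submodule.Quotient.eq F).2 ?_ : (Submodule.Quotient.mk (y - w) : C ⧸ F) = _)
      rw [sub_sub_cancel_left]
      exact neg_mem hw
    · rintro ⟨z, hz⟩
      obtain ⟨z, rfl⟩ := Submodule.Quotient.mk_surjective _ z
      rw [← hz]
      refine (Submodule.Quotient.mk_eq_zero _).2 ?_
      change f z ∈ F'
      rw [LinearMap.mem_ker.1 z.2]
      exact zero_mem _

theorem length_submoduleOf_quotient_eq_add {C : Type*} [AddCommGroup C] [Module R C]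
    {B Z F : Submodule R C} (hBZ : B ≤ Z) (hF : F ⊓ Z ≤ B) :
    Module.length R (Z ⧸ F.submoduleOf Z) =
      Module.length R (B ⧸ F.submoduleOf B) + Module.length R (Z ⧸ B.submoduleOf Z) := by
  have hFB : F.submoduleOf Z ≤ B.submoduleOf Z := fun y hy => hF ⟨hy, y.2⟩
  refine Module.length_eq_add_of_exact
    ((F.submoduleOf B).mapQ (F.submoduleOf Z) (Submodule.inclusion hBZ) fun y hy => hy)
    (Submodule.factor hFB) ?_ (Submodule.factor_surjective hFB) ?_
  · rw [← LinearMap.ker_eq_bot, LinearMap.ker_eq_bot']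
    intro y hy
    obtain ⟨y, rfl⟩ := Submodule.Quotient.mk_surjective _ y
    have hy' : (Submodule.Quotient.mk (Submodule.inclusion hBZ y) : Z ⧸ F.submoduleOf Z) = 0 := hy
    rw [Submodule.Quotient.mk_eq_zero] at hy' ⊢
    exact hy'
  · intro y
    obtain ⟨y, rfl⟩ := Submodule.Quotient.mk_surjective _ y
    constructor
    · intro hy
      have hy' : y ∈ B.submoduleOf Z := (Submodule.Quotient.mk_eq_zero _).1 hy
      exact ⟨Submodule.Quotient.mk ⟨y, hy'⟩, rfl⟩
    · rintro ⟨z, hz⟩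
      obtain ⟨z, rfl⟩ := Submodule.Quotient.mk_surjective _ z
      rw [← hz]
      exact (Submodule.Quotient.mk_eq_zero _).2 z.2

/-- The Euler characteristic of a complex of finite length, with terms of length `c i`, homology of
length `h i` and boundaries of length `b i`, can be computed on homology. -/
theorem alternating_sum_toNat_eq (c h b : ℕ → ℕ∞) (d : ℕ) (hc : ∀ i ≤ d, c i ≠ ⊤)
    (h0 : c 0 = b 0 + h 0) (hs : ∀ i < d, c (i + 1) = b (i + 1) + h (i + 1) + b i)
    (hd : b d = 0) :
    ∑ i ∈ Finset.range (d + 1), (-1 : ℤ) ^ i * ((c i).toNat : ℤ) =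
      ∑ i ∈ Finset.range (d + 1), (-1 : ℤ) ^ i * ((h i).toNat : ℤ) := by
  have key : ∀ n ≤ d, ∑ i ∈ Finset.range (n + 1), (-1 : ℤ) ^ i * ((c i).toNat : ℤ) =
      ∑ i ∈ Finset.range (n + 1), (-1 : ℤ) ^ i * ((h i).toNat : ℤ) +
        (-1) ^ n * ((b n).toNat : ℤ) := by
    intro n
    induction n with
    | zero =>
      intro hn
      have h1 := hc 0 hn
      rw [h0] at h1
      rw [zero_add, Finset.sum_range_one, Finset.sum_range_one, h0,
        ENat.toNat_add (ne_top_of_le_ne_top h1 le_self_add) (ne_top_of_le_ne_top h1 le_add_self)]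
      push_cast
      ring
    | succ n ih =>
      intro hn
      have h1 := hc (n + 1) hn
      rw [hs n hn] at h1
      have h2 := ne_top_of_le_ne_top h1 le_self_add
      rw [Finset.sum_range_succ, ih (by omega), Finset.sum_range_succ _ (n + 1), hs n hn,
        ENat.toNat_add h2 (ne_top_of_le_ne_top h1 le_add_self),
        ENat.toNat_add (ne_top_of_le_ne_top h2 le_self_add) (ne_top_of_le_ne_top h2 le_add_self)]
      push_cast
      ring
  rw [key d le_rfl, hd]
  simp

variable {d : ℕ} (x : Fin d → R) (M : Type v) [AddCommGroup M] [Module R M]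

/-- The Euler characteristic `∑ (-1) ^ i ℓ(H_i(x, M))` of the Koszul complex. -/
noncomputable def koszulEulerChar : ℤ :=
  ∑ i ∈ Finset.range (d + 1), (-1 : ℤ) ^ i * ((koszulHomologyLength x M i).toNat : ℤ)

theorem card_koszulIndex (i : ℕ) : Fintype.card (KoszulIndex d i) = d.choose i := by
  rw [Fintype.card_finset_len, Fintype.card_fin]

/-- For large `k`, the Koszul homology of `M` is that of the quotient of the Koszul complex by the
subcomplex with terms `I ^ (k - i) K_i`, `I = (x)`, because this subcomplex is exact.  Hence the
Euler characteristic is the `d`-th difference of the function `k ↦ ℓ(M / I ^ k M)`. -/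
theorem eventually_alternating_sum_eq_koszulEulerChar [IsNoetherianRing R] [Module.Finite R M]
    (hfin : ∀ n, Module.length R (M ⧸ (Ideal.span (Set.range x) ^ n • (⊤ : Submodule R M))) ≠ ⊤) :
    ∃ k₀, ∀ k ≥ k₀, ∑ i ∈ Finset.range (d + 1), (-1 : ℤ) ^ i * (d.choose i *
      len R (M ⧸ (Ideal.span (Set.range x) ^ (k - i) • (⊤ : Submodule R M))) : ℕ) =
        koszulEulerChar x M := by
  set I := Ideal.span (Set.range x) with hI
  choose c hc using eventually_pow_smul_inf_ker_eq_map (M := M) x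
  refine ⟨(Finset.range (d + 1)).sup c + d + 1, fun k hk => ?_⟩
  -- `F` is the exact subcomplex, and `b i` is the length of the boundaries of degree `i` in the
  -- quotient of the Koszul complex by `F`.
  let F : (i : ℕ) → Submodule R (KoszulIndex d i → M) := fun i => I ^ (k - i) • ⊤
  have hF : ∀ i ≤ d, F i ⊓ LinearMap.ker (koszulDFrom x M i) = (F (i + 1)).map (koszulD x M i) := by
    intro i hi
    have h1 : c i ≤ (Finset.range (d + 1)).sup c :=
      Finset.le_sup (Finset.mem_range.2 (by omega))
    have h2 := hc i (k - (i + 1)) (by omega)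
    rw [show k - (i + 1) + 1 = k - i by omega] at h2
    exact h2
  let b : ℕ → ℕ∞ := fun i => Module.length R (LinearMap.range (koszulD x M i) ⧸
    (F i).submoduleOf (LinearMap.range (koszulD x M i)))
  have hlen : ∀ i, Module.length R ((KoszulIndex d i → M) ⧸ F i) =
      (d.choose i : ℕ) * Module.length R (M ⧸ (I ^ (k - i) • (⊤ : Submodule R M))) := fun i => by
    rw [length_pi_quotient_smul_top, card_koszulIndex]
  have hZ : ∀ i ≤ d, Module.length R (LinearMap.ker (koszulDFrom x M i) ⧸
      (F i).submoduleOf (LinearMap.ker (koszulDFrom x M i))) =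
        b i + koszulHomologyLength x M i := fun i hi =>
    length_submoduleOf_quotient_eq_add (range_koszulD_le_ker x i)
      ((hF i hi).le.trans LinearMap.map_le_range)
  have h := alternating_sum_toNat_eq (fun i => Module.length R ((KoszulIndex d i → M) ⧸ F i))
    (koszulHomologyLength x M) b d ?_ ?_ ?_ ?_
  · rw [koszulEulerChar, ← h]
    refine Finset.sum_congr rfl fun i _ => ?_
    rw [hlen, ENat.toNat_mul, ENat.toNat_natCast]
    rfl
  · intro i _
    rw [hlen]
    exact WithTop.mul_ne_top (ENat.natCast_ne_top _) (hfin _)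
  · rw [← hZ 0 (Nat.zero_le d), length_quotient_eq_add_of_map_eq (koszulDFrom x M 0)
      (F := F 0) (F' := ⊥)]
    · have : Subsingleton (LinearMap.range (koszulDFrom x M 0)) := by
        rw [koszulDFrom, LinearMap.range_zero]
        infer_instance
      rw [Module.length_eq_zero (M := LinearMap.range (koszulDFrom x M 0) ⧸ _), add_zero]
    · rw [bot_inf_eq, koszulDFrom, Submodule.map_zero]
  · intro i hi
    rw [← hZ (i + 1) hi]
    refine length_quotient_eq_add_of_map_eq (koszulD x M i) (le_antisymm ?_ (le_inf ?_ ?_))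
    · exact (inf_le_inf_left _ (range_koszulD_le_ker x i)).trans (hF i hi.le).le
    · exact (hF i hi.le).ge.trans inf_le_left
    · exact LinearMap.map_le_range
  · have : IsEmpty (KoszulIndex d (d + 1)) := by
      rw [← Fintype.card_eq_zero_iff, card_koszulIndex, Nat.choose_succ_self]
    have : Subsingleton (LinearMap.range (koszulD x M d)) := by
      rw [Subsingleton.elim (koszulD x M d) 0, LinearMap.range_zero]
      infer_instance
    exact Module.length_eq_zero

theorem koszulHomologyLength_zero :
    koszulHomologyLength x M 0 =
      Module.length R (M ⧸ (Ideal.span (Set.range x) • (⊤ : Submodule R M))) := by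
  have h := length_quotient_eq_add_of_map_eq (koszulDFrom x M 0)
    (F := LinearMap.range (koszulD x M 0)) (F' := ⊥)
    (by rw [bot_inf_eq, koszulDFrom, Submodule.map_zero])
  have : Subsingleton (LinearMap.range (koszulDFrom x M 0)) := by
    rw [koszulDFrom, LinearMap.range_zero]
    infer_instance
  rw [Module.length_eq_zero (M := LinearMap.range (koszulDFrom x M 0) ⧸ _), add_zero,
    range_koszulD_zero, length_pi_quotient_smul_top, card_koszulIndex, Nat.choose_zero_right,
    Nat.cast_one, one_mul] at h
  rw [h, koszulHomologyLength, range_koszulD_zero]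

theorem koszulEulerChar_eq_quotLen_sub_chiOne :
    koszulEulerChar x M = quotLen x M - chiOne x M := by
  rw [koszulEulerChar, Finset.sum_range_succ', pow_zero, one_mul, koszulHomologyLength_zero,
    add_comm, sub_eq_add_neg, chiOne, ← Finset.sum_neg_distrib,
    ← Finset.Ico_add_one_right_eq_Icc, Finset.sum_Ico_eq_sum_range, Nat.add_sub_cancel]
  refine congrArg _ (Finset.sum_congr rfl fun i _ => ?_)
  rw [len, length_koszulComplex_homology, Nat.add_sub_cancel_left, add_comm 1 i, pow_succ]
  ring

end EulerCharacteristic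

/-! ### Functions with eventually constant finite differences -/

theorem tendsto_choose_div_pow (j : ℕ) :
    Tendsto (fun n : ℕ => (n.choose j : ℝ) / (n : ℝ) ^ j) atTop (𝓝 (1 / (j.factorial : ℝ))) := by
  have h := (isEquivalent_choose j).div (IsEquivalent.refl (u := fun n : ℕ => (n : ℝ) ^ j))
  refine h.symm.tendsto_nhds (tendsto_const_nhds.congr' ?_)
  filter_upwards [eventually_gt_atTop 0] with n hn
  have : (n : ℝ) ^ j ≠ 0 := by positivity
  simp only [Pi.div_apply]
  field_simp

theorem tendsto_choose_div_pow_of_lt {j d : ℕ} (h : j < d) :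
    Tendsto (fun n : ℕ => (n.choose j : ℝ) / (n : ℝ) ^ d) atTop (𝓝 0) := by
  have h1 := (tendsto_choose_div_pow j).mul
    ((tendsto_pow_div_pow_atTop_zero h).comp (tendsto_natCast_atTop_atTop (R := ℝ)))
  rw [mul_zero] at h1
  refine h1.congr' ?_
  filter_upwards [eventually_gt_atTop 0] with n hn
  have : (n : ℝ) ≠ 0 := by positivity
  simp only [Function.comp_apply]
  field_simp

/-- By the Gregory-Newton formula, a function with constant `d`-th difference `c` is a combination
of binomial coefficients with leading term `c * (n choose d)`. -/
theorem tendsto_of_fwdDiff_iter_eq (d : ℕ) (g : ℕ → ℝ) (c : ℝ) (hg : ∀ n, (fwdDiff 1)^[d] g n = c) :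
    Tendsto (fun n : ℕ => (d.factorial : ℝ) * g n / (n : ℝ) ^ d) atTop (𝓝 c) := by
  have hzero : ∀ j > d, (fwdDiff 1)^[j] g = 0 := by
    intro j hj
    obtain ⟨m, rfl⟩ := Nat.exists_eq_add_of_lt hj
    have h1 : (fwdDiff 1)^[d] g = fun _ => c := funext hg
    have h2 : (fwdDiff 1)^[d + 1] g = 0 := by
      rw [Function.iterate_succ_apply', h1]
      exact fwdDiff_const 1 c
    have h3 : ∀ m, (fwdDiff 1)^[m] (0 : ℕ → ℝ) = 0 := fun m => by
      induction m with
      | zero => rfl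
      | succ m ih => rw [Function.iterate_succ_apply', ih]; exact fwdDiff_const 1 (0 : ℝ)
    rw [show d + m + 1 = m + (d + 1) by omega, Function.iterate_add_apply, h2, h3]
  have hsum : ∀ n : ℕ, g n = ∑ j ∈ Finset.range (d + 1), (n.choose j : ℝ) * (fwdDiff 1)^[j] g 0 := by
    intro n
    have h1 := shift_eq_sum_fwdDiff_iter 1 g n 0
    rw [zero_add, smul_eq_mul, mul_one] at h1
    rw [h1]
    simp only [nsmul_eq_mul]
    rcases le_total n d with h | h
    · refine Finset.sum_subset (Finset.range_mono (by omega)) fun j _ hj => ?_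
      rw [Nat.choose_eq_zero_of_lt (by simpa using hj), Nat.cast_zero, zero_mul]
    · refine (Finset.sum_subset (Finset.range_mono (by omega)) fun j _ hj => ?_).symm
      rw [hzero j (by simpa using hj), Pi.zero_apply, mul_zero]
  have hlim : Tendsto (fun n : ℕ => (d.factorial : ℝ) * (∑ j ∈ Finset.range d,
      (n.choose j : ℝ) / (n : ℝ) ^ d * (fwdDiff 1)^[j] g 0 + (n.choose d : ℝ) / (n : ℝ) ^ d * c)) atTop
      (𝓝 ((d.factorial : ℝ) * (∑ j ∈ Finset.range d, 0 * (fwdDiff 1)^[j] g 0 +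
        1 / (d.factorial : ℝ) * c))) := by
    refine (Tendsto.add (tendsto_finsetSum _ fun j hj => ?_)
      ((tendsto_choose_div_pow d).mul_const c)).const_mul _
    exact (tendsto_choose_div_pow_of_lt (Finset.mem_range.1 hj)).mul_const _
  have hd : (d.factorial : ℝ) ≠ 0 := by positivity
  convert hlim using 2
  · rename_i n
    rw [hsum n, Finset.sum_range_succ, hg, mul_div_assoc, add_div, Finset.sum_div]
    congr 2
    · exact Finset.sum_congr rfl fun j _ => by ring
    · ring
  · simp only [zero_mul, Finset.sum_const_zero, zero_add]
    field_simp

theorem tendsto_of_eventually_fwdDiff_iter_eq (d : ℕ) (f : ℕ → ℝ) (c : ℝ) (n₀ : ℕ)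
    (hf : ∀ n ≥ n₀, (fwdDiff 1)^[d] f n = c) :
    Tendsto (fun n : ℕ => (d.factorial : ℝ) * f n / (n : ℝ) ^ d) atTop (𝓝 c) := by
  have h1 := tendsto_of_fwdDiff_iter_eq d (fun n => f (n + n₀)) c fun n => by
    rw [fwdDiff_iter_comp_add]
    exact hf _ (Nat.le_add_left _ _)
  have h2 : Tendsto (fun n : ℕ => ((n : ℝ) / ((n : ℝ) + n₀)) ^ d) atTop (𝓝 (1 ^ d)) :=
    (tendsto_natCast_div_add_atTop (n₀ : ℝ)).pow d
  rw [← tendsto_add_atTop_iff_nat n₀]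
  have h3 := h1.mul h2
  rw [one_pow, mul_one] at h3
  refine h3.congr' ?_
  filter_upwards [eventually_gt_atTop 0] with n hn
  have : (n : ℝ) ≠ 0 := by positivity
  rw [div_pow, Nat.cast_add]
  field_simp

/-! ### Lengths modulo ideals primary to the maximal ideal -/

section LocalLength

variable {R : Type u} [CommRing R]

theorem length_quotient_smul_top_le (J : Ideal R) (M : Type v) [AddCommGroup M] [Module R M]
    [Module.Finite R M] :
    Module.length R (M ⧸ (J • (⊤ : Submodule R M))) ≤
      (minGen R M : ℕ) * Module.length R (R ⧸ J) := by
  obtain ⟨s, hs, hspan⟩ :=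
    (Module.Finite.fg_top (R := R) (M := M)).exists_span_finset_card_eq_spanFinrank
  let f : (s → R) →ₗ[R] M := Fintype.linearCombination R (fun i : s => (i : M))
  have hf : LinearMap.range f = ⊤ := by
    rw [Fintype.range_linearCombination, Subtype.range_coe_subtype]
    exact hspan
  have hle : J • (⊤ : Submodule R (s → R)) ≤ (J • (⊤ : Submodule R M)).comap f := by
    rw [← Submodule.map_le_iff_le_comap, Submodule.map_smul'']
    exact Submodule.smul_mono le_rfl le_top
  have hsurj : Function.Surjective (Submodule.mapQ _ _ f hle) := by
    intro y
    obtain ⟨y, rfl⟩ := Submodule.Quotient.mk_surjective _ y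
    obtain ⟨z, rfl⟩ := LinearMap.range_eq_top.1 hf y
    exact ⟨Submodule.Quotient.mk z, rfl⟩
  refine (Module.length_le_of_surjective _ hsurj).trans_eq ?_
  have hJ : J • (⊤ : Submodule R R) = J := Ideal.mul_top J
  rw [length_pi_quotient_smul_top, Fintype.card_coe, hs, hJ]
  rfl

variable [IsLocalRing R]

/-- By Nakayama's lemma, `ν(M)` is the length of `M / m M`, a quotient of `M / I M`. -/
theorem minGen_le_length {I : Ideal R} (hI : I ≤ IsLocalRing.maximalIdeal R)
    (M : Type v) [AddCommGroup M] [Module R M] [Module.Finite R M] :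
    (minGen R M : ℕ∞) ≤ Module.length R (M ⧸ (I • (⊤ : Submodule R M))) := by
  let := Ideal.Quotient.field (IsLocalRing.maximalIdeal R)
  rw [minGen, IsLocalRing.spanFinrank_eq_finrank_quotient _ Module.Finite.fg_top]
  have hfin : Module.Finite R
    (↥(⊤ : Submodule R M) ⧸ IsLocalRing.maximalIdeal R • (⊤ : Submodule R (⊤ : Submodule R M))) :=
    inferInstance
  have : Module.Finite (R ⧸ IsLocalRing.maximalIdeal R)
    (↥(⊤ : Submodule R M) ⧸ IsLocalRing.maximalIdeal R • (⊤ : Submodule R (⊤ : Submodule R M))) :=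
    Module.Finite.of_restrictScalars_finite R _ _
  rw [← Module.length_eq_finrank (R ⧸ IsLocalRing.maximalIdeal R),
    ← Module.length_eq_of_surjective (S := R) Ideal.Quotient.mk_surjective]
  have hle : I • (⊤ : Submodule R M) ≤
      (IsLocalRing.maximalIdeal R • (⊤ : Submodule R (⊤ : Submodule R M))).comap
        (Submodule.topEquiv (R := R) (M := M)).symm.toLinearMap := by
    rw [← Submodule.map_le_iff_le_comap, Submodule.map_smul'']
    exact Submodule.smul_mono hI le_top
  refine Module.length_le_of_surjective (Submodule.mapQ _ _ _ hle) fun y => ?_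
  obtain ⟨y, rfl⟩ := Submodule.Quotient.mk_surjective _ y
  exact ⟨Submodule.Quotient.mk y.1, rfl⟩

theorem radical_span_range_eq {d : ℕ} {w w' : Fin d → R}
    (hw : (Ideal.span (Set.range w)).radical = IsLocalRing.maximalIdeal R)
    (h : ∀ j, w' j ∈ IsLocalRing.maximalIdeal R)
    (h' : ∀ j, w j ∈ (Ideal.span (Set.range w')).radical) :
    (Ideal.span (Set.range w')).radical = IsLocalRing.maximalIdeal R := by
  refine le_antisymm ?_ ?_
  · rw [(IsLocalRing.maximalIdeal.isMaximal R).isPrime.isRadical.radical_le_iff, Ideal.span_le]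
    rintro _ ⟨j, rfl⟩
    exact h j
  · rw [← hw, (Ideal.radical_isRadical _).radical_le_iff, Ideal.span_le]
    rintro _ ⟨j, rfl⟩
    exact h' j

theorem mem_maximalIdeal_of_radical_eq {d : ℕ} {w : Fin d → R}
    (hw : (Ideal.span (Set.range w)).radical = IsLocalRing.maximalIdeal R) (j : Fin d) :
    w j ∈ IsLocalRing.maximalIdeal R :=
  hw ▸ Ideal.le_radical (Ideal.subset_span ⟨j, rfl⟩)

theorem radical_span_range_pow_eq {d : ℕ} {w : Fin d → R}
    (hw : (Ideal.span (Set.range w)).radical = IsLocalRing.maximalIdeal R) {t : ℕ} (ht : 0 < t) :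
    (Ideal.span (Set.range fun j => w j ^ t)).radical = IsLocalRing.maximalIdeal R :=
  radical_span_range_eq hw
    (fun j => Ideal.pow_mem_of_mem _ (mem_maximalIdeal_of_radical_eq hw j) t ht)
    fun j => ⟨t, Ideal.subset_span ⟨j, rfl⟩⟩

variable [IsNoetherianRing R]

theorem length_quotient_ideal_ne_top {I : Ideal R}
    (hI : I.radical = IsLocalRing.maximalIdeal R) : Module.length R (R ⧸ I) ≠ ⊤ := by
  have hIm : I ≤ IsLocalRing.maximalIdeal R := hI ▸ Ideal.le_radical
  have : Nontrivial (R ⧸ I) := Ideal.Quotient.nontrivial_iff.2 fun h =>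
    (IsLocalRing.maximalIdeal.isMaximal R).ne_top (top_le_iff.1 (h ▸ hIm))
  have hsurj : Function.Surjective (Ideal.Quotient.mk I) := Ideal.Quotient.mk_surjective
  have : IsLocalRing (R ⧸ I) := IsLocalRing.of_surjective' _ hsurj
  have : IsArtinianRing (R ⧸ I) := by
    rw [isArtinianRing_iff_isNilpotent_maximalIdeal]
    obtain ⟨n, hn⟩ := I.exists_radical_pow_le_of_fg (IsNoetherian.noetherian _)
    refine ⟨n, ?_⟩
    rw [← IsLocalRing.map_maximalIdeal_of_surjective _ hsurj, ← Ideal.map_pow,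
      Ideal.zero_eq_bot, Ideal.map_eq_bot_iff_le_ker, Ideal.mk_ker, ← hI]
    exact hn
  rw [Module.length_eq_of_surjective (R := R ⧸ I) (S := R) hsurj]
  exact Module.length_ne_top

theorem length_quotient_pow_ne_top {I : Ideal R} (hI : I.radical = IsLocalRing.maximalIdeal R)
    (M : Type v) [AddCommGroup M] [Module R M] [Module.Finite R M] (n : ℕ) :
    Module.length R (M ⧸ (I ^ n • (⊤ : Submodule R M))) ≠ ⊤ := by
  refine ne_top_of_le_ne_top (WithTop.mul_ne_top (ENat.natCast_ne_top _) ?_)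
    (length_quotient_smul_top_le (I ^ n) M)
  rcases eq_or_ne n 0 with rfl | hn
  · have : Subsingleton (R ⧸ I ^ 0) := by
      rw [pow_zero, Ideal.one_eq_top]
      infer_instance
    rw [Module.length_eq_zero]
    exact ENat.zero_ne_top
  · exact length_quotient_ideal_ne_top ((I.radical_pow hn).trans hI)

theorem length_quotient_smul_top_ne_top {I : Ideal R}
    (hI : I.radical = IsLocalRing.maximalIdeal R)
    (M : Type v) [AddCommGroup M] [Module R M] [Module.Finite R M] :
    Module.length R (M ⧸ (I • (⊤ : Submodule R M))) ≠ ⊤ := by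
  have h := length_quotient_pow_ne_top hI M 1
  rwa [pow_one] at h

end LocalLength

/-! ### Multiplicities and the comparison of `χ₁` for different sequences -/

section Comparison

variable {R : Type u} [CommRing R] [IsLocalRing R] [IsNoetherianRing R] {d : ℕ}

/-- Serre's formula: the normalized leading coefficient of `k ↦ ℓ(M / (w) ^ k M)` is the Euler
characteristic `ℓ(M / (w) M) - χ₁(w, M)` of the Koszul complex. -/
theorem tendsto_factorial_mul_len_div_pow {w : Fin d → R}
    (hw : (Ideal.span (Set.range w)).radical = IsLocalRing.maximalIdeal R)
    (M : Type v) [AddCommGroup M] [Module R M] [Module.Finite R M] :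
    Tendsto (fun k : ℕ => (d.factorial : ℝ) *
        (len R (M ⧸ (Ideal.span (Set.range w) ^ k • (⊤ : Submodule R M))) : ℝ) / (k : ℝ) ^ d)
      atTop (𝓝 ((quotLen w M : ℝ) - (chiOne w M : ℝ))) := by
  obtain ⟨k₀, hk₀⟩ := eventually_alternating_sum_eq_koszulEulerChar w M
    (length_quotient_pow_ne_top hw M)
  refine tendsto_of_eventually_fwdDiff_iter_eq d _ _ k₀ fun n hn => ?_
  have h := congrArg (Int.cast : ℤ → ℝ) (hk₀ (n + d) (by omega))
  rw [koszulEulerChar_eq_quotLen_sub_chiOne] at h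
  push_cast at h
  rw [← h, fwdDiff_iter_eq_sum_shift, ← Finset.sum_range_reflect]
  refine Finset.sum_congr rfl fun i hi => ?_
  have hi' : i ≤ d := Nat.lt_succ_iff.1 (Finset.mem_range.1 hi)
  rw [show d + 1 - 1 - i = d - i by omega, Nat.sub_sub_self hi', Nat.choose_symm hi', smul_eq_mul,
    mul_one, show n + (d - i) = n + d - i by omega, zsmul_eq_mul]
  push_cast
  ring

theorem tendsto_add_choose_div_pow (d : ℕ) :
    Tendsto (fun k : ℕ => (d.factorial : ℝ) * ((d + k).choose d : ℝ) / (k : ℝ) ^ d)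
      atTop (𝓝 1) := by
  have h1 := ((tendsto_choose_div_pow d).const_mul (d.factorial : ℝ)).comp
    (tendsto_add_atTop_nat d)
  have h2 := ((tendsto_natCast_div_add_atTop (𝕜 := ℝ) (d : ℝ)).inv₀ one_ne_zero).pow d
  have h3 := h1.mul h2
  have hd : (d.factorial : ℝ) ≠ 0 := by positivity
  rw [mul_one_div_cancel hd, inv_one, one_pow, mul_one] at h3
  refine h3.congr' ?_
  filter_upwards [eventually_gt_atTop 0] with k hk
  have hk' : (k : ℝ) ≠ 0 := by positivity
  have hkd : ((k : ℝ) + d) ≠ 0 := by positivity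
  simp only [Function.comp_apply]
  rw [add_comm d k, Nat.cast_add, inv_div, div_pow]
  field_simp

/-- If `I = J + (a)` with `J` generated by `d` elements, the multiplicities of `J` and `I` differ by
at most `ℓ(M / J M) - ℓ(M / I M)`. -/
theorem quotLen_sub_chiOne_le {w : Fin d → R}
    (hw : (Ideal.span (Set.range w)).radical = IsLocalRing.maximalIdeal R) {I : Ideal R} {a : R}
    (hI : I = Ideal.span (Set.range w) ⊔ Ideal.span {a})
    (M : Type v) [AddCommGroup M] [Module R M] [Module.Finite R M] {e : ℝ}
    (he : Tendsto (fun k : ℕ => (d.factorial : ℝ) *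
      (len R (M ⧸ (I ^ k • (⊤ : Submodule R M))) : ℝ) / (k : ℝ) ^ d) atTop (𝓝 e)) :
    (quotLen w M : ℝ) - (chiOne w M : ℝ) ≤
      e + ((quotLen w M : ℝ) - (len R (M ⧸ (I • (⊤ : Submodule R M))) : ℝ)) := by
  set J := Ideal.span (Set.range w) with hJ
  have hJI : J ≤ I := hI ▸ le_sup_left
  have hfin := length_quotient_smul_top_ne_top hw M
  have hfinp := length_quotient_pow_ne_top hw M
  have hadd := length_quotient_eq_add (Submodule.smul_mono_left hJI : J • (⊤ : Submodule R M) ≤ _)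
  set c := Module.length R (↥(I • (⊤ : Submodule R M)) ⧸
          (J • (⊤ : Submodule R M)).submoduleOf (I • ⊤)) with hc
  rw [hadd] at hfin
  have hcfin : c ≠ ⊤ := ne_top_of_le_ne_top hfin le_self_add
  have hIfin := ne_top_of_le_ne_top hfin le_add_self
  have hq : (quotLen w M : ℝ) = c.toNat + (len R (M ⧸ (I • (⊤ : Submodule R M))) : ℝ) := by
    rw [quotLen, len, hadd, ENat.toNat_add hcfin hIfin, Nat.cast_add]
    rfl
  have hlen : ∀ k, (len R (M ⧸ (J ^ k • (⊤ : Submodule R M))) : ℝ) ≤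
      len R (M ⧸ (I ^ k • (⊤ : Submodule R M))) + ((d + k).choose d : ℝ) * (c.toNat : ℝ) := by
    intro k
    have h := length_quotient_pow_le (M := M) w a k hJ hI
    have h1 : Module.length R (M ⧸ (I ^ k • (⊤ : Submodule R M))) ≠ ⊤ :=
      ne_top_of_le_ne_top (hfinp k)
        (length_quotient_anti (Submodule.smul_mono_left (Ideal.pow_right_mono hJI k)))
    have h2 : ((d + k).choose d : ℕ∞) * c ≠ ⊤ := WithTop.mul_ne_top (ENat.natCast_ne_top _) hcfin
    have h3 := ENat.toNat_le_toNat h (WithTop.add_ne_top.2 ⟨h1, h2⟩)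
    rw [ENat.toNat_add h1 h2, ENat.toNat_mul, ENat.toNat_natCast] at h3
    exact_mod_cast h3
  have hlim := he.add ((tendsto_add_choose_div_pow d).mul_const (c.toNat : ℝ))
  have hle := le_of_tendsto_of_tendsto' (tendsto_factorial_mul_len_div_pow hw M) hlim fun k => by
    rw [div_mul_eq_mul_div, ← add_div, mul_assoc, ← mul_add]
    gcongr
    exact hlen k
  rw [one_mul] at hle
  linarith

/-- The case `I = R`, `a = 1` of the comparison of multiplicities. -/
theorem chiOne_nonneg {w : Fin d → R}
    (hw : (Ideal.span (Set.range w)).radical = IsLocalRing.maximalIdeal R)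
    (M : Type v) [AddCommGroup M] [Module R M] [Module.Finite R M] :
    (0 : ℝ) ≤ chiOne w M := by
  have hzero : ∀ k, len R (M ⧸ ((⊤ : Ideal R) ^ k • (⊤ : Submodule R M))) = 0 := fun k => by
    have : Subsingleton (M ⧸ ((⊤ : Ideal R) ^ k • (⊤ : Submodule R M))) := by
      rw [Ideal.top_pow, Submodule.top_smul]
      infer_instance
    rw [len, Module.length_eq_zero]
    rfl
  have h := quotLen_sub_chiOne_le hw (I := ⊤) (a := 1) (e := 0)
    (by rw [Ideal.span_singleton_one, sup_top_eq]) M (by simp [hzero])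
  have h1 := hzero 1
  rw [pow_one] at h1
  rw [h1, Nat.cast_zero] at h
  linarith

/-- Enlarging the ideal by one element, while keeping the number of generators, decreases
`χ₁`. -/
theorem chiOne_update_le {w : Fin d → R}
    (hw : (Ideal.span (Set.range w)).radical = IsLocalRing.maximalIdeal R) {i : Fin d} {a : R}
    (ha : a ∈ IsLocalRing.maximalIdeal R)
    (hi : w i ∈ Ideal.span (Set.range (Function.update w i a)))
    (M : Type v) [AddCommGroup M] [Module R M] [Module.Finite R M] :
    (chiOne (Function.update w i a) M : ℝ) ≤ chiOne w M := by
  obtain ⟨h1, h2⟩ := span_range_update_le_iff.1 (le_refl (Ideal.span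
    (Set.range (Function.update w i a))))
  have hmem : ∀ j, w j ∈ Ideal.span (Set.range (Function.update w i a)) := fun j => by
    by_cases hj : j = i
    · exact hj ▸ hi
    · exact h2 j hj
  have hspan : Ideal.span (Set.range (Function.update w i a)) =
      Ideal.span (Set.range w) ⊔ Ideal.span {a} := by
    refine le_antisymm (span_range_update_le_iff.2
      ⟨Ideal.mem_sup_right (Ideal.mem_span_singleton_self a), fun j _ =>
        Ideal.mem_sup_left (Ideal.subset_span ⟨j, rfl⟩)⟩) (sup_le ?_ ?_)
    · rw [Ideal.span_le]
      rintro _ ⟨j, rfl⟩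
      exact hmem j
    · rwa [Ideal.span_singleton_le_iff_mem]
  have hw' : (Ideal.span (Set.range (Function.update w i a))).radical =
      IsLocalRing.maximalIdeal R := by
    refine radical_span_range_eq hw ?_ fun j => Ideal.le_radical (hmem j)
    rw [Function.forall_update_iff w (p := fun _ r => r ∈ IsLocalRing.maximalIdeal R)]
    exact ⟨ha, fun j _ => mem_maximalIdeal_of_radical_eq hw j⟩
  have h := quotLen_sub_chiOne_le hw hspan M (tendsto_factorial_mul_len_div_pow hw' M)
  change _ ≤ _ + (_ - (quotLen (Function.update w i a) M : ℝ)) at h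
  linarith

/-- The length of `M / (w) M` grows at most by the factor `t ^ d` when `w` is replaced by its `t`-th
powers, while the multiplicity grows at least by that factor, as `(w_j ^ t) ^ k ⊆ (w) ^ (t k)`. -/
theorem chiOne_pow_le {w : Fin d → R}
    (hw : (Ideal.span (Set.range w)).radical = IsLocalRing.maximalIdeal R) {t : ℕ} (ht : 0 < t)
    (M : Type v) [AddCommGroup M] [Module R M] [Module.Finite R M] :
    (chiOne (fun j => w j ^ t) M : ℝ) ≤ (t : ℝ) ^ d * chiOne w M := by
  have hwt := radical_span_range_pow_eq hw ht
  have hq : (quotLen (fun j => w j ^ t) M : ℝ) ≤ (t : ℝ) ^ d * quotLen w M := by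
    have h1 := length_quotient_smul_top_ne_top hw M
    have h2 := ENat.toNat_le_toNat (length_quotient_pow_vector_le (M := M) w t)
      (WithTop.mul_ne_top (ENat.natCast_ne_top _) h1)
    rw [ENat.toNat_mul, ENat.toNat_natCast] at h2
    exact_mod_cast h2
  have hlen : ∀ k, len R (M ⧸ (Ideal.span (Set.range w) ^ (k * t) • (⊤ : Submodule R M))) ≤
      len R (M ⧸ (Ideal.span (Set.range fun j => w j ^ t) ^ k • (⊤ : Submodule R M))) := by
    intro k
    refine ENat.toNat_le_toNat (length_quotient_anti (Submodule.smul_mono_left ?_))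
      (length_quotient_pow_ne_top hwt M k)
    rw [mul_comm, pow_mul]
    refine Ideal.pow_right_mono ?_ k
    rw [Ideal.span_le]
    rintro _ ⟨j, rfl⟩
    have hj : w j ∈ Ideal.span (Set.range w) := Ideal.subset_span ⟨j, rfl⟩
    exact Ideal.pow_mem_pow hj t
  have he : (t : ℝ) ^ d * ((quotLen w M : ℝ) - chiOne w M) ≤
      (quotLen (fun j => w j ^ t) M : ℝ) - chiOne (fun j => w j ^ t) M := by
    have h1 := ((tendsto_factorial_mul_len_div_pow hw M).comp
      (tendsto_id.atTop_mul_const' ht)).const_mul ((t : ℝ) ^ d)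
    refine le_of_tendsto_of_tendsto' h1 (tendsto_factorial_mul_len_div_pow hwt M) fun k => ?_
    have ht' : (t : ℝ) ≠ 0 := by positivity
    have h2 : (len R (M ⧸ (Ideal.span (Set.range w) ^ (k * t) • (⊤ : Submodule R M))) : ℝ) ≤
      len R (M ⧸ (Ideal.span (Set.range fun j => w j ^ t) ^ k • (⊤ : Submodule R M))) := by
      exact_mod_cast hlen k
    simp only [Function.comp_apply, id]
    rw [Nat.cast_mul, mul_pow, mul_comm ((k : ℝ) ^ d), ← mul_div_assoc,
      mul_div_mul_left _ _ (pow_ne_zero d ht')]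
    gcongr
  linarith

end Comparison

/-! ### Independence of the system of parameters -/

section Independence

variable {R : Type u} [CommRing R] {d : ℕ}

/-- `χ₁(y, M) ≤ C χ₁(x, M)` for all finitely generated modules `M`, with a constant `C` that does
not depend on `M`. -/
def ChiOneDominates (x y : Fin d → R) : Prop :=
  ∃ C : ℝ, 0 ≤ C ∧ ∀ (M : Type v) [AddCommGroup M] [Module R M] [Module.Finite R M],
    (chiOne y M : ℝ) ≤ C * chiOne x M

theorem ChiOneDominates.trans {x y z : Fin d → R} (h : ChiOneDominates.{u, v} x y)
    (h' : ChiOneDominates.{u, v} y z) : ChiOneDominates.{u, v} x z := by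
  obtain ⟨C, hC, h⟩ := h
  obtain ⟨C', hC', h'⟩ := h'
  refine ⟨C' * C, mul_nonneg hC' hC, fun M _ _ _ => ?_⟩
  rw [mul_assoc]
  exact (h' M).trans (mul_le_mul_of_nonneg_left (h M) hC')

theorem chiOneDominates_refl (x : Fin d → R) : ChiOneDominates.{u, v} x x :=
  ⟨1, zero_le_one, fun M _ _ _ => by rw [one_mul]⟩

variable [IsLocalRing R] [IsNoetherianRing R]

/-- Exchanging one element of `w`: with `t` such that `w i ^ t` lies in the new ideal, one passes
from `w` to the powers `w j ^ t`, back to `w j` for `j ≠ i`, and finally from `w i ^ t` to `z`.  Every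
move after the first adds a single element to the ideal. -/
theorem chiOneDominates_update {w : Fin d → R}
    (hw : (Ideal.span (Set.range w)).radical = IsLocalRing.maximalIdeal R) {i : Fin d} {z : R}
    (hz : (Ideal.span (Set.range (Function.update w i z))).radical =
      IsLocalRing.maximalIdeal R) :
    ChiOneDominates.{u, v} w (Function.update w i z) := by
  obtain ⟨s, hs⟩ : w i ∈ (Ideal.span (Set.range (Function.update w i z))).radical :=
    hz ▸ mem_maximalIdeal_of_radical_eq hw i
  set t := s + 1 with ht
  have ht0 : 0 < t := Nat.succ_pos s
  have hwt : w i ^ t ∈ Ideal.span (Set.range (Function.update w i z)) := by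
    rw [ht, pow_succ]
    exact Ideal.mul_mem_right _ _ hs
  have hzm : z ∈ IsLocalRing.maximalIdeal R := by
    simpa using mem_maximalIdeal_of_radical_eq hz i
  have hprim : ∀ S : Finset (Fin d),
      (Ideal.span (Set.range (S.piecewise w fun j => w j ^ t))).radical =
        IsLocalRing.maximalIdeal R := by
    refine fun S => radical_span_range_eq hw (fun j => ?_) fun j => ⟨t, ?_⟩
    · exact S.piecewise_cases w (fun j => w j ^ t) (· ∈ IsLocalRing.maximalIdeal R)
        (mem_maximalIdeal_of_radical_eq hw j)
        (Ideal.pow_mem_of_mem _ (mem_maximalIdeal_of_radical_eq hw j) t ht0)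
    · have hj : S.piecewise w (fun j => w j ^ t) j ∈
          Ideal.span (Set.range (S.piecewise w fun j => w j ^ t)) :=
        Ideal.subset_span ⟨j, rfl⟩
      by_cases hjS : j ∈ S
      · rw [Finset.piecewise_eq_of_mem _ _ _ hjS] at hj
        exact Ideal.pow_mem_of_mem _ hj t ht0
      · rwa [Finset.piecewise_eq_of_notMem _ _ _ hjS] at hj
  refine ⟨(t : ℝ) ^ d, by positivity, fun M _ _ _ => ?_⟩
  have key : ∀ S : Finset (Fin d), (chiOne (S.piecewise w fun j => w j ^ t) M : ℝ) ≤
      (t : ℝ) ^ d * chiOne w M := by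
    intro S
    induction S using Finset.induction_on with
    | empty =>
      rw [Finset.piecewise_empty]
      exact chiOne_pow_le hw ht0 M
    | insert j S hj ih =>
      rw [Finset.piecewise_insert]
      refine (chiOne_update_le (hprim S) (mem_maximalIdeal_of_radical_eq hw j) ?_ M).trans ih
      rw [Finset.piecewise_eq_of_notMem _ _ _ hj]
      have hj' := (span_range_update_le_iff.1 (le_refl (Ideal.span
        (Set.range (Function.update (S.piecewise w fun j => w j ^ t) j (w j)))))).1
      exact Ideal.pow_mem_of_mem _ hj' t ht0
  -- With every `w j`, `j ≠ i`, restored, it remains to add `z`, which makes `w i ^ t` superfluous.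
  have hup : (Finset.univ.erase i).piecewise w (fun j => w j ^ t) =
      Function.update w i (w i ^ t) := by
    funext j
    by_cases hj : j = i
    · subst hj
      simp
    · rw [Finset.piecewise_eq_of_mem _ _ _ (Finset.mem_erase.2 ⟨hj, Finset.mem_univ j⟩),
        Function.update_of_ne hj]
  have h1 := key (Finset.univ.erase i)
  have h2 := hprim (Finset.univ.erase i)
  rw [hup] at h1 h2
  have h3 := chiOne_update_le (a := z) (i := i) h2 hzm (by
    rwa [Function.update_idem, Function.update_self]) M
  rw [Function.update_idem] at h3
  exact h3.trans h1

/-- If `z` lies in no prime that is minimal over the elements `w j` with `j ≠ i`, then it may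
replace `w i`. -/
theorem radical_span_range_update_eq {w : Fin d → R}
    (hw : (Ideal.span (Set.range w)).radical = IsLocalRing.maximalIdeal R) {i : Fin d} {z : R}
    (hzm : z ∈ IsLocalRing.maximalIdeal R)
    (hz : ∀ p ∈ (Ideal.span (w '' {i}ᶜ)).minimalPrimes, z ∉ p) :
    (Ideal.span (Set.range (Function.update w i z))).radical = IsLocalRing.maximalIdeal R := by
  have hm : (IsLocalRing.maximalIdeal R).IsPrime := (IsLocalRing.maximalIdeal.isMaximal R).isPrime
  refine le_antisymm ?_ ?_
  · rw [hm.isRadical.radical_le_iff, span_range_update_le_iff]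
    exact ⟨hzm, fun j _ => mem_maximalIdeal_of_radical_eq hw j⟩
  rw [Ideal.radical_eq_sInf]
  refine le_sInf fun q ⟨hq, hqp⟩ => ?_
  by_contra hqm
  have hlt : q < IsLocalRing.maximalIdeal R :=
    lt_of_le_not_ge (IsLocalRing.le_maximalIdeal hqp.ne_top) hqm
  obtain ⟨hzq, hjq⟩ := span_range_update_le_iff.1 hq
  refine hz q (Ideal.mem_minimalPrimes_span_of_mem_minimalPrimes_span_insert hlt (w i)
    (w '' {i}ᶜ) ?_ (w '' {i}ᶜ) ?_ ?_) hzq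
  · rw [← Set.image_insert_eq, ← Set.union_singleton, Set.compl_union_self, Set.image_univ,
      ← Ideal.radical_minimalPrimes, hw, Ideal.minimalPrimes_eq_subsingleton_self]
    rfl
  · rintro _ ⟨j, hj, rfl⟩
    exact hjq j hj
  · exact fun r hr => Ideal.le_radical (Ideal.subset_span (Set.mem_insert_of_mem _ hr))

/-- Two systems of parameters can be changed in the same position into systems of parameters that
agree there. -/
theorem exists_update_isSystemOfParameters {x y : Fin d → R} (hx : IsSystemOfParameters x)
    (hy : IsSystemOfParameters y) (i : Fin d) :
    ∃ z, IsSystemOfParameters (Function.update x i z) ∧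
      IsSystemOfParameters (Function.update y i z) := by
  -- By Krull's height theorem, `d - 1` elements generate no ideal over which the maximal ideal,
  -- of height `d`, is minimal.
  have hne : ∀ w : Fin d → R, ∀ p ∈ (Ideal.span (w '' {i}ᶜ)).minimalPrimes,
      ¬ IsLocalRing.maximalIdeal R ≤ p := by
    intro w p hp hmp
    have h1 := Ideal.height_le_card_of_mem_minimalPrimes_span (Set.toFinite _) hp
    have h2 : (d : ℕ∞) ≤ p.height := by
      have h3 := IsLocalRing.maximalIdeal_height_eq_ringKrullDim (R := R)
      rw [hx.1] at h3
      have h4 : (IsLocalRing.maximalIdeal R).height = (d : ℕ∞) := by exact_mod_cast h3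
      exact h4 ▸ Ideal.height_mono hmp
    have h3 : d ≤ (w '' {i}ᶜ).ncard := by exact_mod_cast h2.trans h1
    have h4 : ({i}ᶜ : Set (Fin d)).ncard = d - 1 := by
      rw [Set.ncard_compl, Set.ncard_singleton, Nat.card_fin]
    have h5 := Set.ncard_image_le (f := w) (Set.toFinite ({i}ᶜ : Set (Fin d)))
    have := i.pos
    omega
  set s := (Ideal.span (x '' {i}ᶜ)).minimalPrimes ∪ (Ideal.span (y '' {i}ᶜ)).minimalPrimes
  have hs : s.Finite := (Ideal.finite_minimalPrimes_of_isNoetherianRing R _).union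
    (Ideal.finite_minimalPrimes_of_isNoetherianRing R _)
  have hprime : ∀ p ∈ s, p.IsPrime := by
    rintro p (hp | hp) <;> exact hp.1.1
  have hcover : ¬ ((IsLocalRing.maximalIdeal R : Set R) ⊆ ⋃ p ∈ s, (p : Set R)) := by
    intro h
    obtain ⟨p, hp, hmp⟩ := (Ideal.subset_union_prime_finite hs (f := id) 0 0
      fun p hp _ _ => hprime p hp).1 h
    rcases hp with hp | hp
    · exact hne x p hp hmp
    · exact hne y p hp hmp
  obtain ⟨z, hzm, hz⟩ := Set.not_subset.1 hcover
  have hz' : ∀ p ∈ s, z ∉ p := fun p hp hzp => hz (Set.mem_biUnion hp hzp)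
  exact ⟨z, ⟨hx.1, radical_span_range_update_eq hx.2 hzm fun p hp => hz' p (Or.inl hp)⟩,
    ⟨hy.1, radical_span_range_update_eq hy.2 hzm fun p hp => hz' p (Or.inr hp)⟩⟩

/-- Exchanging one position at a time, on the side of `x` and on that of `y`, for common generic
elements, one arrives at the same system of parameters from both sides. -/
theorem IsSystemOfParameters.chiOneDominates {x y : Fin d → R} (hx : IsSystemOfParameters x)
    (hy : IsSystemOfParameters y) : ChiOneDominates.{u, v} x y := by
  have key : ∀ S : Finset (Fin d), ∃ x' y' : Fin d → R, IsSystemOfParameters x' ∧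
      IsSystemOfParameters y' ∧ ChiOneDominates.{u, v} x x' ∧ ChiOneDominates.{u, v} y' y ∧
        ∀ j ∈ S, x' j = y' j := by
    intro S
    induction S using Finset.induction_on with
    | empty =>
      exact ⟨x, y, hx, hy, chiOneDominates_refl x, chiOneDominates_refl y, by simp⟩
    | insert i S hi ih =>
      obtain ⟨x', y', hx', hy', hxx', hyy', h⟩ := ih
      obtain ⟨z, hxz, hyz⟩ := exists_update_isSystemOfParameters hx' hy' i
      refine ⟨_, _, hxz, hyz, hxx'.trans (chiOneDominates_update hx'.2 hxz.2),
        ChiOneDominates.trans ?_ hyy', ?_⟩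
      · have h1 := chiOneDominates_update.{u, v} (z := y' i) (i := i) hyz.2 (by
          rw [Function.update_idem, Function.update_eq_self]
          exact hy'.2)
        rwa [Function.update_idem, Function.update_eq_self] at h1
      · intro j hj
        by_cases hji : j = i
        · rw [hji, Function.update_self, Function.update_self]
        · rw [Function.update_of_ne hji, Function.update_of_ne hji]
          exact h j (Finset.mem_of_mem_insert_of_ne hj hji)
  obtain ⟨x', y', -, -, hxx', hyy', h⟩ := key Finset.univ
  obtain rfl : x' = y' := funext fun j => h j (Finset.mem_univ j)
  exact hxx'.trans hyy'

end Independence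

/-! ### Sequences of modules -/

section Sequences

variable {R : Type u} [CommRing R] [IsLocalRing R] [IsNoetherianRing R] {d : ℕ}

theorem hilbertSamuelMultiplicity_eq {x : Fin d → R} (hx : IsSystemOfParameters x)
    (M : Type v) [AddCommGroup M] [Module R M] [Module.Finite R M] :
    hilbertSamuelMultiplicity (Ideal.span (Set.range x)) M =
      (quotLen x M : ℝ) - (chiOne x M : ℝ) := by
  have hd : ((ringKrullDim R).unbotD 0).toNat = d := by
    rw [hx.1]
    rfl
  rw [hilbertSamuelMultiplicity, hd]
  exact (tendsto_factorial_mul_len_div_pow hx.2 M).limUnder_eq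

theorem minGen_le_quotLen {x : Fin d → R} (hx : IsSystemOfParameters x)
    (M : Type v) [AddCommGroup M] [Module R M] [Module.Finite R M] :
    minGen R M ≤ quotLen x M := by
  have h := ENat.toNat_le_toNat (minGen_le_length (hx.2 ▸ Ideal.le_radical) M)
    (length_quotient_smul_top_ne_top hx.2 M)
  rwa [ENat.toNat_natCast] at h

theorem quotLen_le_minGen_mul {x : Fin d → R} (hx : IsSystemOfParameters x)
    (M : Type v) [AddCommGroup M] [Module R M] [Module.Finite R M] :
    quotLen x M ≤ minGen R M * len R (R ⧸ Ideal.span (Set.range x)) := by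
  have h := ENat.toNat_le_toNat (length_quotient_smul_top_le (Ideal.span (Set.range x)) M)
    (WithTop.mul_ne_top (ENat.natCast_ne_top _) (length_quotient_ideal_ne_top hx.2))
  rwa [ENat.toNat_mul, ENat.toNat_natCast] at h

theorem quotLen_pos {x : Fin d → R} (hx : IsSystemOfParameters x)
    (M : Type v) [AddCommGroup M] [Module R M] [Module.Finite R M]
    (hM : Module.supportDim R M = ringKrullDim R) : 0 < quotLen x M := by
  refine lt_of_lt_of_le (Nat.pos_of_ne_zero fun h => ?_) (minGen_le_quotLen hx M)
  rw [minGen, Submodule.spanFinrank_eq_zero_iff_eq_bot Module.Finite.fg_top] at h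
  have : Subsingleton M := (Submodule.subsingleton_iff R).1 (subsingleton_of_bot_eq_top h.symm)
  rw [Module.supportDim_eq_bot_of_subsingleton, hx.1] at hM
  exact WithBot.bot_ne_coe hM

variable (M : ℕ → Type v) [∀ n, AddCommGroup (M n)] [∀ n, Module R (M n)]

theorem isTheta_quotLen_minGen {x : Fin d → R} (hx : IsSystemOfParameters x)
    (hfin : ∀ n, Module.Finite R (M n)) :
    (fun n => (quotLen x (M n) : ℝ)) =Θ[atTop] fun n => (minGen R (M n) : ℝ) := by
  refine ⟨IsBigO.of_bound (len R (R ⧸ Ideal.span (Set.range x)) : ℝ) (Eventually.of_forall ?_),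
    IsBigO.of_bound 1 (Eventually.of_forall ?_)⟩
  · intro n
    rw [Real.norm_natCast, Real.norm_natCast, mul_comm]
    exact_mod_cast quotLen_le_minGen_mul hx (M n)
  · intro n
    rw [Real.norm_natCast, Real.norm_natCast, one_mul]
    exact_mod_cast minGen_le_quotLen hx (M n)

theorem isLittleO_minGen_iff {x : Fin d → R} (hx : IsSystemOfParameters x)
    (hfin : ∀ n, Module.Finite R (M n))
    (hdim : ∀ n, Module.supportDim R (M n) = ringKrullDim R) :
    (fun n => (chiOne x (M n) : ℝ)) =o[atTop] (fun n => (minGen R (M n) : ℝ)) ↔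
      Tendsto (fun n => (chiOne x (M n) : ℝ) / (quotLen x (M n) : ℝ)) atTop (𝓝 0) := by
  rw [← (isTheta_quotLen_minGen M hx hfin).isLittleO_congr_right, isLittleO_iff_tendsto']
  refine Eventually.of_forall fun n h => absurd h ?_
  exact_mod_cast (quotLen_pos hx (M n) (hdim n)).ne'

theorem tendsto_multiplicity_div_iff {x : Fin d → R} (hx : IsSystemOfParameters x)
    (hfin : ∀ n, Module.Finite R (M n))
    (hdim : ∀ n, Module.supportDim R (M n) = ringKrullDim R) :
    Tendsto (fun n => hilbertSamuelMultiplicity (Ideal.span (Set.range x)) (M n) /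
        (quotLen x (M n) : ℝ)) atTop (𝓝 1) ↔
      Tendsto (fun n => (chiOne x (M n) : ℝ) / (quotLen x (M n) : ℝ)) atTop (𝓝 0) := by
  have h : (fun n => hilbertSamuelMultiplicity (Ideal.span (Set.range x)) (M n) /
      (quotLen x (M n) : ℝ)) =
      fun n => 1 - (chiOne x (M n) : ℝ) / (quotLen x (M n) : ℝ) := by
    funext n
    have hq : (quotLen x (M n) : ℝ) ≠ 0 := by
      exact_mod_cast (quotLen_pos hx (M n) (hdim n)).ne'
    rw [hilbertSamuelMultiplicity_eq hx, sub_div, div_self hq]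
  rw [h]
  constructor <;> intro h1
  · simpa using h1.const_sub 1
  · simpa using h1.const_sub 1

end Sequences

end LimCM

theorem mainTheorem4 {R : Type u} [CommRing R] [IsLocalRing R] [IsNoetherianRing R]
    (M : ℕ → Type v) [∀ n, AddCommGroup (M n)] [∀ n, Module R (M n)]
    (hfin : ∀ n, Module.Finite R (M n))
    (hdim : ∀ n, Module.supportDim R (M n) = ringKrullDim R) :
    (∀ (d : ℕ) (x : Fin d → R), LimCM.IsSystemOfParameters x →
      List.TFAE
        [Tendsto (fun n => LimCM.hilbertSamuelMultiplicity (Ideal.span (Set.range x)) (M n) /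
            (LimCM.quotLen x (M n) : ℝ)) atTop (𝓝 1),
         Tendsto (fun n => (LimCM.chiOne x (M n) : ℝ) / (LimCM.quotLen x (M n) : ℝ))
            atTop (𝓝 0),
         (fun n => (LimCM.chiOne x (M n) : ℝ)) =o[atTop]
            (fun n => (LimCM.minGen R (M n) : ℝ))]) ∧
    (LimCM.IsWeaklyLimCohenMacaulay R M →
      ∀ (d : ℕ) (x : Fin d → R), LimCM.IsSystemOfParameters x →
        Tendsto (fun n => LimCM.hilbertSamuelMultiplicity (Ideal.span (Set.range x)) (M n) /
            (LimCM.quotLen x (M n) : ℝ)) atTop (𝓝 1) ∧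
        Tendsto (fun n => (LimCM.chiOne x (M n) : ℝ) / (LimCM.quotLen x (M n) : ℝ))
            atTop (𝓝 0) ∧
        (fun n => (LimCM.chiOne x (M n) : ℝ)) =o[atTop]
            (fun n => (LimCM.minGen R (M n) : ℝ))) := by
  refine ⟨fun d x hx => ?_, fun hM d x hx => ?_⟩
  · tfae_have 1 ↔ 2 := LimCM.tendsto_multiplicity_div_iff M hx hfin hdim
    tfae_have 3 ↔ 2 := LimCM.isLittleO_minGen_iff M hx hfin hdim
    tfae_finish
  · obtain ⟨d', y, hy, hyo⟩ := hM.exists_isLittleO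
    obtain rfl : d' = d := by exact_mod_cast hy.1.symm.trans hx.1
    obtain ⟨C, hC, hle⟩ := hy.chiOneDominates.{u, v} hx
    have ho : (fun n => (LimCM.chiOne x (M n) : ℝ)) =o[atTop]
        (fun n => (LimCM.minGen R (M n) : ℝ)) := by
      refine IsBigO.trans_isLittleO (IsBigO.of_bound C (Eventually.of_forall fun n => ?_)) hyo
      rw [Real.norm_of_nonneg (LimCM.chiOne_nonneg hx.2 (M n)),
        Real.norm_of_nonneg (LimCM.chiOne_nonneg hy.2 (M n))]
      exact hle (M n)
    have h2 := (LimCM.isLittleO_minGen_iff M hx hfin hdim).1 ho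
    exact ⟨(LimCM.tendsto_multiplicity_div_iff M hx hfin hdim).2 h2, h2, ho⟩
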